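/- Let $R$ be a commutative Noetherian ring. Complexes $X=(\cdots\to X_{i+1}\to X_i\to X_{i-1}\to\cdots)$ of $R$-modules are indexed by $\mathbb{Z}$; $X$ is homologically finite if $\mathrm{H}_i(X)$ is finitely generated for all $i$ and $\mathrm{H}_i(X)=0$ for $|i|\gg 0$. Write $X\simeq Y$ if $X$ and $Y$ are connected by a finite zigzag of quasiisomorphisms. A full subcategory $\mathcal{B}$ of the category of finitely generated $R$-modules is a resolving subclass if (1) it contains every finitely generated projective $R$-module; (2) for each exact sequence $0\to A\to B\to C\to 0$ of finitely generated $R$-modules with $C\in\mathcal{B}$, one has $A\in\mathcal{B}$ if and only if $B\in\mathcal{B}$; (3) if $A,C$ are finitely generated and $A\oplus C\in\mathcal{B}$, then $A,C\in\mathcal{B}$. A $\mathcal{B}$-resolution of a homologically finite complex $X$ is a bounded below complex $B\simeq X$ with each $B_i$ in $\mathcal{B}$, and $$\mathcal{B}\text{-}\dim_R(X)=\inf\{\sup\{i\mid B_i\neq 0\}\mid B\text{ is a }\mathcal{B}\text{-resolution of }X\}\in\{-\infty\}\cup\mathbb{Z}\cup\{\infty\}.$$ Let $0\to X^1\to X^2\to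 X^3\to 0$ be an exact sequence of homologically finite complexes of $R$-modules and let $i,j,k$ be integers with $\{i,j,k\}=\{1,2,3\}$. Then for every resolving subclass $\mathcal{B}$, $$\mathcal{B}\text{-}\dim_R(X^k)\leq\max\{\mathcal{B}\text{-}\dim_R(X^i),\mathcal{B}\text{-}\dim_R(X^j)\}+1.$$ In particular, if $\mathcal{B}\text{-}\dim_R(X^i)<\infty$ and $\mathcal{B}\text{-}\dim_R(X^j)<\infty$, then $\mathcal{B}\text{-}\dim_R(X^k)<\infty$. Moreover, let $\mathrm{CI}_*(R)$ be the class of totally reflexive $R$-modules $T$ such that for every maximal ideal $\mathfrak{m}$ of $R$ the module $T_{\mathfrak{m}}$ has finite complexity over $R_{\mathfrak{m}}$. Here a finitely generated module $T$ is totally reflexive if it is reflexive and $\mathrm{Ext}^n_R(T,R)=0=\mathrm{Ext}^n_R(\mathrm{Hom}_R(T,R),R)$ for all $n>0$; and the complexity of a finitely generated module $M$ over a Noetherian local ring is the infimum of the $c\in\mathbb{N}$ for which there is $\alpha\in\mathbb{R}$ with $\beta_n(M)\leq\alpha n^{c-1}$ for all $n\gg 0$, where $\beta_n(M)$ is the rank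 in degree $n$ of a minimal free resolution of $M$. Then $\mathrm{CI}_*(R)$ is a resolving subclass, and hence both assertions above hold for the resulting dimension $\mathrm{CI}_*\text{-}\dim_R$. -/

import Mathlib

open CategoryTheory CategoryTheory.Limits Filter

universe u

noncomputable section

/-! ### Complexes of modules, indexed homologically by the integers -/

section Complexes

variable {R : Type u} [CommRing R]

/-- A complex is homologically finite if its homology is bounded and degreewise finite. -/
def IsHomologicallyFinite (X : ChainComplex (ModuleCat.{u} R) ℤ) : Prop :=
  (∃ n : ℤ, ∀ i : ℤ, n < |i| → IsZero (X.homology i)) ∧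
    ∀ i : ℤ, Module.Finite R (X.homology i)

/-- `X ≃ Y`: the complexes are connected by a finite zigzag of quasiisomorphisms. -/
def QuasiIsomorphic (X Y : ChainComplex (ModuleCat.{u} R) ℤ) : Prop :=
  Relation.EqvGen
    (fun A B : ChainComplex (ModuleCat.{u} R) ℤ => ∃ α : A ⟶ B, QuasiIso α) X Y

/-- A complex is bounded below if it vanishes in all sufficiently small degrees. -/
def IsBoundedBelow (X : ChainComplex (ModuleCat.{u} R) ℤ) : Prop :=
  ∃ n : ℤ, ∀ i : ℤ, i < n → IsZero (X.X i)

end Complexes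

/-! ### Resolving subclasses and the associated dimension -/

section Resolving

variable {R : Type u} [CommRing R]

/-- A resolving subclass of the category of finite `R`-modules.  The full subcategory is given by
its class of objects. -/
structure IsResolvingSubclass (B : ObjectProperty (ModuleCat.{u} R)) : Prop where
  /-- all members are finite modules -/
  finite : ∀ M : ModuleCat.{u} R, B M → Module.Finite R M
  /-- all finitely generated projective modules are members -/
  projective : ∀ P : ModuleCat.{u} R, Module.Finite R P → Module.Projective R P → B P
  /-- in an exact sequence `0 → L → M → N → 0` of finite modules with `N` a member,
  `L` is a member if and only if `M` is -/
  exact : ∀ S : ShortComplex (ModuleCat.{u} R), S.ShortExact →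
    Module.Finite R S.X₁ → Module.Finite R S.X₂ → Module.Finite R S.X₃ →
    B S.X₃ → (B S.X₁ ↔ B S.X₂)
  /-- closure under direct summands -/
  summand : ∀ L N : ModuleCat.{u} R, Module.Finite R L → Module.Finite R N →
    B (ModuleCat.of R (L × N)) → B L ∧ B N

/-- `A` is a `B`-resolution of the complex `X`. -/
structure IsClassResolution (B : ObjectProperty (ModuleCat.{u} R))
    (A X : ChainComplex (ModuleCat.{u} R) ℤ) : Prop where
  boundedBelow : IsBoundedBelow A
  mem : ∀ i : ℤ, B (A.X i)
  quasiIsomorphic : QuasiIsomorphic A X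

/-- `sup {i | A_i ≠ 0}`, which is `-∞` if `A = 0`. -/
def supDegree (A : ChainComplex (ModuleCat.{u} R) ℤ) : EReal :=
  ⨆ (i : ℤ) (_ : ¬ IsZero (A.X i)), ((i : ℝ) : EReal)

/-- The `B`-dimension of `X`: the infimum of `sup {i | A_i ≠ 0}` over all `B`-resolutions `A`. -/
def classDim (B : ObjectProperty (ModuleCat.{u} R))
    (X : ChainComplex (ModuleCat.{u} R) ℤ) : EReal :=
  ⨅ (A : ChainComplex (ModuleCat.{u} R) ℤ) (_ : IsClassResolution B A X), supDegree A

end Resolving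

/-! ### Betti numbers and complexity of a module over a local ring -/

section Complexity

variable {A : Type u} [CommRing A] [IsLocalRing A]

/-- A minimal free resolution: a resolution by finite free modules whose differential has image in
the maximal ideal times the target. -/
def IsMinimalFreeResolution {M : ModuleCat.{u} A} (F : ProjectiveResolution M) : Prop :=
  (∀ n : ℕ, Module.Finite A (F.complex.X n) ∧ Module.Free A (F.complex.X n)) ∧
    ∀ n : ℕ, LinearMap.range (F.complex.d (n + 1) n).hom ≤
      IsLocalRing.maximalIdeal A • (⊤ : Submodule A (F.complex.X n))

/-- The `n`th Betti number: the rank in degree `n` of a minimal free resolution.  Over a Noetherian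
local ring every finite module has such a resolution, unique up to isomorphism, so that the set
below is a singleton. -/
def bettiNumber (M : ModuleCat.{u} A) (n : ℕ) : ℕ :=
  sInf {b : ℕ | ∃ F : ProjectiveResolution M,
    IsMinimalFreeResolution F ∧ b = Module.finrank A (F.complex.X n)}

/-- The complexity: the infimum of all natural numbers `c` such that for some real `α` the Betti
numbers satisfy `β_n ≤ α n ^ (c - 1)` for all large `n`. -/
def complexity (M : ModuleCat.{u} A) : ℕ∞ :=
  ⨅ (c : ℕ) (_ : ∃ α : ℝ, ∀ᶠ n : ℕ in atTop,
    (bettiNumber M n : ℝ) ≤ α * (n : ℝ) ^ ((c : ℤ) - 1)), (c : ℕ∞)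

end Complexity

/-! ### Lower complete intersection dimension -/

section LowerCI

variable {R : Type u} [CommRing R]

/-- A finite module `M` is totally reflexive if it is reflexive and
`Ext^i(M, R) = 0 = Ext^i(M^*, R)` for all `i > 0`. -/
structure IsTotallyReflexive (M : ModuleCat.{u} R) : Prop where
  finite : Module.Finite R M
  reflexive : Module.IsReflexive R M
  ext_eq_zero : ∀ i : ℕ, 0 < i → Subsingleton (Abelian.Ext M (ModuleCat.of R R) i)
  ext_dual_eq_zero : ∀ i : ℕ, 0 < i →
    Subsingleton (Abelian.Ext (ModuleCat.of R (Module.Dual R M)) (ModuleCat.of R R) i)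

/-- The class `CI_*(R)`: totally reflexive modules whose localization at each maximal ideal has
finite complexity. -/
def lowerCIClass (R : Type u) [CommRing R] : ObjectProperty (ModuleCat.{u} R) := fun T =>
  IsTotallyReflexive T ∧ ∀ (m : Ideal R) [m.IsMaximal],
    complexity (ModuleCat.of (Localization.AtPrime m) (LocalizedModule m.primeCompl T)) < ⊤

/-- The lower complete intersection dimension, or `CI_*`-dimension. -/
def lowerCIDim (X : ChainComplex (ModuleCat.{u} R) ℤ) : EReal :=
  classDim (lowerCIClass R) X

end LowerCI

end

noncomputable section

/-! ### Elementary closure properties of resolving subclasses -/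

section ResolvingClosure

variable {R : Type u} [CommRing R] {B : ObjectProperty (ModuleCat.{u} R)}

/-! The dimension is read off in the derived category. Write S_n for the members of `B` placed in
cohomological degree n, and P * Q for the objects X in a triangle Y → X → Z → Y[1] with Y in P and Z
in Q. Brutal truncation shows that a complex with entries in `B` in degrees a, …, a + k lies in
S_{a+k} * (… * S_a), which is `layers B a k`. Conversely, such an iterated extension is built as a
complex by taking successive cocones, because a derived map from a complex bounded above by n to a
module in degree n is an honest chain map. Hence admitting a resolution that vanishes above n means
lying in `boundedLayers B (-n)` (`exists_isClassResolution_iff`).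

The crux is that this class is closed under extensions (`extensionProduct_layers_le`): layers
occurring in the wrong order must be sorted. A new top module N on the right is replaced by a
presentation 0 → K → F → N → 0 with F free. No map from F to lower degrees survives, so F moves to
the far left, while K[1] falls one degree lower and is absorbed by induction; K is in `B` because
`B` is resolving. Rotating the triangle of the short exact sequence then gives all three
inequalities. A shift by 1 costs one degree, and it is needed only for the third term.

For `lowerCIClass`, total reflexivity passes through exact sequences by long exact sequences and a
chase with evaluation maps. Finite complexity means polynomial growth of the length of Ext^n(M, k),
k the residue field, since these lengths are the Betti numbers for n > 0
(`bettiNumber_eq_extLength`); subadditivity of length does the rest, after localization. -/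

lemma IsResolvingSubclass.of_isZero (hB : IsResolvingSubclass B) {M : ModuleCat.{u} R}
    (hM : IsZero M) : B M := by
  have : Subsingleton M := ModuleCat.subsingleton_of_isZero hM
  exact hB.projective M inferInstance inferInstance

/-- Isomorphism invariance is not an axiom; it follows from the exactness axiom applied to 0 → 0 → N
→ M → 0, whose kernel is a member. -/
lemma IsResolvingSubclass.of_iso (hB : IsResolvingSubclass B) {M N : ModuleCat.{u} R}
    (e : M ≅ N) (hM : B M) : B N := by
  have := hB.finite M hM
  have : Module.Finite R N := Module.Finite.equiv e.toLinearEquiv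
  have hS : (ShortComplex.mk (0 : ModuleCat.of R PUnit.{u + 1} ⟶ N) e.inv
      (by simp)).ShortExact := by
    have hz : IsZero (ModuleCat.of R PUnit.{u + 1}) := ModuleCat.isZero_of_subsingleton _
    refine ShortComplex.ShortExact.mk' ?_ ?_ ?_
    · exact (ShortComplex.exact_iff_mono _ rfl).2 (by dsimp; infer_instance)
    · exact ⟨fun _ _ _ => hz.eq_of_tgt _ _⟩
    · dsimp; infer_instance
  have h0 : B (ModuleCat.of R PUnit.{u + 1}) :=
    hB.of_isZero (ModuleCat.isZero_of_subsingleton _)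
  exact (hB.exact _ hS (hB.finite _ h0) this ‹_› hM).1 h0

lemma IsResolvingSubclass.of_shortExact [IsNoetherianRing R] (hB : IsResolvingSubclass B)
    {S : ShortComplex (ModuleCat.{u} R)} (hS : S.ShortExact) (h₁ : B S.X₁) (h₃ : B S.X₃) :
    B S.X₂ := by
  have := hB.finite _ h₁
  have := hB.finite _ h₃
  have := isNoetherian_of_range_eq_ker S.f.hom S.g.hom hS.exact.moduleCat_range_eq_ker
  exact (hB.exact S hS ‹_› inferInstance ‹_› h₃).1 h₁

lemma IsResolvingSubclass.exists_shortExact_projective [IsNoetherianRing R]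
    (hB : IsResolvingSubclass B) {N : ModuleCat.{u} R} (hN : B N) :
    ∃ (K F : ModuleCat.{u} R) (i : K ⟶ F) (p : F ⟶ N) (w : i ≫ p = 0),
      (ShortComplex.mk i p w).ShortExact ∧ B K ∧ B F ∧ Projective F := by
  have := hB.finite N hN
  obtain ⟨n, f, hf⟩ := Module.Finite.exists_fin' R N
  have hS := LinearMap.shortExact_shortComplexKer hf
  have hF : B (ModuleCat.of R (Fin n → R)) :=
    hB.projective _ (inferInstanceAs (Module.Finite R (Fin n → R)))
      (inferInstanceAs (Module.Projective R (Fin n → R)))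
  refine ⟨_, _, _, _, _, hS, ?_, hF, ?_⟩
  · exact (hB.exact _ hS (inferInstanceAs (Module.Finite R (LinearMap.ker f)))
      (inferInstanceAs (Module.Finite R (Fin n → R))) ‹_› hN).2 hF
  · exact (IsProjective.iff_projective (R := R) (Fin n → R)).1 inferInstance

end ResolvingClosure

/-! ### Iterated extensions of shifted modules in the derived category -/

section Layers

open DerivedCategory Pretriangulated ObjectProperty

variable {R : Type u} [CommRing R] [HasDerivedCategory.{u + 1} (ModuleCat.{u} R)]

/-- The objects of the derived category isomorphic to a member of `B` placed in
cohomological degree `n`. -/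
def singleLayer (B : ObjectProperty (ModuleCat.{u} R)) (n : ℤ) :
    ObjectProperty (DerivedCategory (ModuleCat.{u} R)) :=
  fun X => ∃ M, B M ∧ Nonempty (X ≅ (singleFunctor (ModuleCat.{u} R) n).obj M)

/-- The iterated extensions of members of `B` placed in the degrees `a, …, a + k`. -/
def layers (B : ObjectProperty (ModuleCat.{u} R)) (a : ℤ) :
    ℕ → ObjectProperty (DerivedCategory (ModuleCat.{u} R))
  | 0 => singleLayer B a
  | k + 1 => extensionProduct (singleLayer B (a + k + 1)) (layers B a k)

instance (B : ObjectProperty (ModuleCat.{u} R)) (n : ℤ) :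
    (singleLayer B n).IsClosedUnderIsomorphisms where
  of_iso := by
    rintro X Y e ⟨M, hM, ⟨e'⟩⟩
    exact ⟨M, hM, ⟨e.symm ≪≫ e'⟩⟩

instance (B : ObjectProperty (ModuleCat.{u} R)) (a : ℤ) (k : ℕ) :
    (layers B a k).IsClosedUnderIsomorphisms := by
  cases k <;> (unfold layers; infer_instance)

variable {B : ObjectProperty (ModuleCat.{u} R)}

lemma containsZero_singleLayer (hB : IsResolvingSubclass B) (n : ℤ) :
    (singleLayer B n).ContainsZero where
  exists_zero := ⟨_, (singleFunctor (ModuleCat.{u} R) n).map_isZero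
    (ModuleCat.isZero_of_subsingleton (ModuleCat.of R PUnit.{u + 1})), _,
    hB.of_isZero (ModuleCat.isZero_of_subsingleton _), ⟨Iso.refl _⟩⟩

lemma isLE_of_singleLayer {n : ℤ} {X : DerivedCategory (ModuleCat.{u} R)}
    (hX : singleLayer B n X) : X.IsLE n := by
  obtain ⟨M, -, ⟨e⟩⟩ := hX
  exact TStructure.t.isLE_of_iso e.symm n

lemma isGE_of_singleLayer {n : ℤ} {X : DerivedCategory (ModuleCat.{u} R)}
    (hX : singleLayer B n X) : X.IsGE n := by
  obtain ⟨M, -, ⟨e⟩⟩ := hX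
  exact TStructure.t.isGE_of_iso e.symm n

lemma isLE₂_of_distTriang {T : Triangle (DerivedCategory (ModuleCat.{u} R))}
    (hT : T ∈ distTriang _) (n : ℤ) (h₁ : T.obj₁.IsLE n) (h₃ : T.obj₃.IsLE n) :
    T.obj₂.IsLE n := by
  rw [isLE_iff] at h₁ h₃ ⊢
  exact fun i hi => (HomologySequence.exact₂ T hT i).isZero_of_both_zeros
    ((h₁ i hi).eq_of_src _ _) ((h₃ i hi).eq_of_tgt _ _)

lemma isGE₂_of_distTriang {T : Triangle (DerivedCategory (ModuleCat.{u} R))}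
    (hT : T ∈ distTriang _) (n : ℤ) (h₁ : T.obj₁.IsGE n) (h₃ : T.obj₃.IsGE n) :
    T.obj₂.IsGE n := by
  rw [isGE_iff] at h₁ h₃ ⊢
  exact fun i hi => (HomologySequence.exact₂ T hT i).isZero_of_both_zeros
    ((h₁ i hi).eq_of_src _ _) ((h₃ i hi).eq_of_tgt _ _)

lemma isLE_of_layers {a : ℤ} {k : ℕ} {X : DerivedCategory (ModuleCat.{u} R)}
    (hX : layers B a k X) : X.IsLE (a + k) := by
  induction k generalizing X with
  | zero => simpa using isLE_of_singleLayer hX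
  | succ k ih =>
    obtain ⟨Y, Z, f, g, h, hT, hY, hZ⟩ := hX
    have := ih hZ
    refine isLE₂_of_distTriang hT _ ?_ (TStructure.t.isLE_of_le Z (a + k) _)
    simpa [add_assoc] using isLE_of_singleLayer hY

/-- An extension of members of `B` placed in one degree is a member of `B` in that degree. -/
lemma extensionProduct_singleLayer_self_le [IsNoetherianRing R] (hB : IsResolvingSubclass B)
    (n : ℤ) : extensionProduct (singleLayer B n) (singleLayer B n) ≤ singleLayer B n := by
  intro X ⟨Y, Z, f, g, h, hT, hY, hZ⟩
  have hY' := hY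
  have hZ' := hZ
  obtain ⟨M, hM, ⟨eM⟩⟩ := hY
  obtain ⟨N, hN, ⟨eN⟩⟩ := hZ
  have : X.IsLE n := isLE₂_of_distTriang hT n (isLE_of_singleLayer hY') (isLE_of_singleLayer hZ')
  have : X.IsGE n := isGE₂_of_distTriang hT n (isGE_of_singleLayer hY') (isGE_of_singleLayer hZ')
  -- X has cohomology only in degree n, so it is a module L. The long exact sequence then presents L
  -- as an extension of N by M, since H^{n-1}(Z) and H^{n+1}(Y) vanish.
  obtain ⟨L, ⟨eL⟩⟩ := exists_iso_singleFunctor_obj_of_isGE_of_isLE X n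
  have hH := singleFunctorCompHomologyFunctorIso (ModuleCat.{u} R) n
  have w : (homologyFunctor _ n).map f ≫ (homologyFunctor _ n).map g = 0 := by
    rw [← Functor.map_comp]
    exact (congrArg _ (comp_distTriang_mor_zero₁₂ _ hT)).trans (Functor.map_zero _ _ _)
  have hex : (ShortComplex.mk _ _ w).ShortExact := by
    have := isGE_of_singleLayer hZ'
    have := isLE_of_singleLayer hY'
    refine ShortComplex.ShortExact.mk' (HomologySequence.exact₂ _ hT n) ?_ ?_
    · refine (HomologySequence.mono_homologyMap_mor₁_iff _ hT (n - 1) n).2 ?_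
      exact (isZero_of_isGE Z n (n - 1) (by lia)).eq_of_src _ _
    · refine (HomologySequence.epi_homologyMap_mor₂_iff _ hT n (n + 1)).2 ?_
      exact (isZero_of_isLE Y n (n + 1) (by lia)).eq_of_tgt _ _
  have hL := hB.of_shortExact hex
    (hB.of_iso ((homologyFunctor _ n).mapIso eM ≪≫ hH.app M).symm hM)
    (hB.of_iso ((homologyFunctor _ n).mapIso eN ≪≫ hH.app N).symm hN)
  exact ⟨L, hB.of_iso ((homologyFunctor _ n).mapIso eL ≪≫ hH.app L) hL, ⟨eL⟩⟩

/-- A projective member of `B` in the top degree can be moved to the left. -/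
lemma extensionProduct_singleLayer_projective_le
    {P : ObjectProperty (DerivedCategory (ModuleCat.{u} R))} {n : ℤ}
    (hP : ∀ X, P X → X.IsLE n) :
    extensionProduct P (singleLayer (B ⊓ isProjective _) n) ≤
      extensionProduct (singleLayer B n) P := by
  intro X ⟨Y, Z, f, g, h, hT, hY, F, ⟨hF, hF'⟩, ⟨e⟩⟩
  have : Projective F := hF'
  have := hP Y hY
  -- The connecting map goes from a projective in degree n to Y[1], which lives in degrees ≤ n - 1;
  -- it vanishes, the triangle splits, and the two summands can be swapped.
  have h0 : h = 0 := by
    have : (Y⟦(1 : ℤ)⟧).IsLE (n - 1) := TStructure.t.isLE_shift Y n 1 (n - 1)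
    obtain ⟨L, _, ⟨e'⟩⟩ := exists_iso_Q_obj_of_isLE (Y⟦(1 : ℤ)⟧) (n - 1)
    have := from_singleFunctor_obj_eq_zero_of_projective (P := F) (i := n)
      (e.inv ≫ h ≫ e'.hom) (n - 1) (by lia)
    rw [← cancel_epi e.inv, ← cancel_mono e'.hom, Category.assoc, comp_zero, zero_comp]
    exact this
  obtain ⟨e', -, -⟩ := exists_iso_binaryBiproduct_of_distTriang _ hT h0
  refine prop_of_iso _ (biprod.braiding _ _ ≪≫ e'.symm) ?_
  exact ⟨_, _, _, _, _, binaryBiproductTriangle_distinguished Z Y, ⟨F, hF, ⟨e⟩⟩, hY⟩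

/-- Every member of `B` in degree `n` is an extension of a projective member in degree `n`
and a member in degree `n - 1`. -/
lemma singleLayer_le_extensionProduct [IsNoetherianRing R] (hB : IsResolvingSubclass B) (n m : ℤ)
    (hm : m + 1 = n) :
    singleLayer B n ≤
      extensionProduct (singleLayer (B ⊓ isProjective _) n) (singleLayer B m) := by
  intro X ⟨N, hN, ⟨e⟩⟩
  refine prop_of_iso _ e.symm ?_
  obtain ⟨K, F, i, p, w, hS, hK, hF, hF'⟩ := hB.exists_shortExact_projective hN
  have hT := triangleOfSES_distinguished
    (hS.map_of_exact (HomologicalComplex.single (ModuleCat.{u} R) (ComplexShape.up ℤ) n))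
  -- The rotated triangle is F → N → K[1], and the shift puts K in degree n - 1.
  exact ⟨_, _, _, _, _, rot_of_distTriang _ hT, ⟨F, ⟨hF, hF'⟩, ⟨Iso.refl _⟩⟩,
    K, hK, ⟨((singleFunctors (ModuleCat.{u} R)).shiftIso 1 m n (by lia)).app K⟩⟩

section Absorption

variable [IsNoetherianRing R]

/-- The sorting step: split the right-hand module into a free part and a syzygy, move the free part
to the front, and let `h` absorb the syzygy in degree a + k. -/
lemma extensionProduct_layers_le_succ_of_absorb (hB : IsResolvingSubclass B) (a : ℤ) (k : ℕ)
    (h : extensionProduct (layers B a k) (singleLayer B (a + k)) ≤ layers B a k) :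
    extensionProduct (layers B a k) (singleLayer B (a + k + 1)) ≤ layers B a (k + 1) := by
  refine (monotone_extensionProduct_right _
    (singleLayer_le_extensionProduct hB (a + k + 1) (a + k) rfl)).trans ?_
  rw [← extensionProduct_assoc]
  refine (monotone_extensionProduct_left _ (extensionProduct_singleLayer_projective_le
    (fun X hX => ?_))).trans ?_
  · have := isLE_of_layers hX
    exact TStructure.t.isLE_of_le X (a + k) _
  · rw [extensionProduct_assoc]
    exact monotone_extensionProduct_right _ h

lemma extensionProduct_layers_singleLayer_le (hB : IsResolvingSubclass B) (a : ℤ) (k j : ℕ) (hj : j ≤ k) :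
    extensionProduct (layers B a k) (singleLayer B (a + j)) ≤ layers B a k := by
  induction k generalizing j with
  | zero =>
    obtain rfl : j = 0 := by lia
    simpa [layers] using extensionProduct_singleLayer_self_le hB a
  | succ k ih =>
    change extensionProduct (extensionProduct (singleLayer B (a + k + 1)) (layers B a k)) _ ≤
      extensionProduct (singleLayer B (a + k + 1)) (layers B a k)
    rw [extensionProduct_assoc]
    rcases hj.lt_or_eq with hj | rfl
    · exact monotone_extensionProduct_right _ (ih j (by lia))
    -- The new module sits in the top degree: sorting it yields two adjacent top layers, which then
    -- merge into one.
    · refine (monotone_extensionProduct_right _ (by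
        simpa [add_assoc] using extensionProduct_layers_le_succ_of_absorb hB a k
          (ih k le_rfl))).trans ?_
      rw [layers, ← extensionProduct_assoc]
      exact monotone_extensionProduct_left _ (extensionProduct_singleLayer_self_le hB _)

lemma extensionProduct_layers_le (hB : IsResolvingSubclass B) (a : ℤ) (k j : ℕ) (hj : j ≤ k) :
    extensionProduct (layers B a k) (layers B a j) ≤ layers B a k := by
  induction j with
  | zero => simpa [layers] using extensionProduct_layers_singleLayer_le hB a k 0 hj
  | succ j ih =>
    rw [layers, ← extensionProduct_assoc]
    refine (monotone_extensionProduct_left _ ?_).trans (ih (by lia))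
    simpa [add_assoc] using extensionProduct_layers_singleLayer_le hB a k (j + 1) hj

end Absorption

end Layers

/-! ### Objects of the derived category built from a resolving subclass -/

section LayersTriangle

open DerivedCategory Pretriangulated ObjectProperty

variable {R : Type u} [CommRing R] [HasDerivedCategory.{u + 1} (ModuleCat.{u} R)]
  {B : ObjectProperty (ModuleCat.{u} R)}

lemma singleLayer_shift {a n a' : ℤ} (h : n + a' = a) {X : DerivedCategory (ModuleCat.{u} R)}
    (hX : singleLayer B a X) : singleLayer B a' (X⟦n⟧) := by
  obtain ⟨M, hM, ⟨e⟩⟩ := hX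
  exact ⟨M, hM, ⟨(shiftFunctor _ n).mapIso e ≪≫
    ((singleFunctors (ModuleCat.{u} R)).shiftIso n a' a h).app M⟩⟩

lemma layers_shift {a n a' : ℤ} (h : n + a' = a) (k : ℕ) {X : DerivedCategory (ModuleCat.{u} R)}
    (hX : layers B a k X) : layers B a' k (X⟦n⟧) := by
  induction k generalizing X with
  | zero => exact singleLayer_shift h hX
  | succ k ih =>
    obtain ⟨Y, Z, f, g, δ, hT, hY, hZ⟩ := hX
    exact ⟨_, _, _, _, _, Triangle.shift_distinguished _ hT n,
      singleLayer_shift (by lia) hY, ih hZ⟩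

/-- Pad with a zero module on top, so that two objects can be given equally many layers. -/
lemma layers_le_succ (hB : IsResolvingSubclass B) (a : ℤ) (k : ℕ) :
    layers B a k ≤ layers B a (k + 1) :=
  have := containsZero_singleLayer hB (a + k + 1)
  le_extensionProduct_right (singleLayer B (a + k + 1))

lemma layers_monotone (hB : IsResolvingSubclass B) (a : ℤ) : Monotone (layers B a) :=
  monotone_nat_of_le_succ (layers_le_succ hB a)

lemma layers_le_pred (hB : IsResolvingSubclass B) (a : ℤ) (k : ℕ) :
    layers B a k ≤ layers B (a - 1) (k + 1) := by
  induction k with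
  | zero =>
    have := containsZero_singleLayer hB (a - 1)
    simpa [layers] using le_extensionProduct_left (P := singleLayer B a) (Q := singleLayer B (a - 1))
  | succ k ih =>
    have := monotone_extensionProduct_right (singleLayer B (a + k + 1)) ih
    have e : a - 1 + (k + 1 : ℕ) + 1 = a + k + 1 := by push_cast; ring
    change _ ≤ extensionProduct (singleLayer B (a - 1 + (k + 1 : ℕ) + 1)) _
    rwa [e]

/-- The finite iterated extensions of members of `B` placed in cohomological degrees `≥ a`. -/
def boundedLayers (B : ObjectProperty (ModuleCat.{u} R)) (a : ℤ) :
    ObjectProperty (DerivedCategory (ModuleCat.{u} R)) :=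
  fun X => ∃ k, layers B a k X

lemma boundedLayers_le_pred (hB : IsResolvingSubclass B) (a : ℤ) :
    boundedLayers B a ≤ boundedLayers B (a - 1) :=
  fun X ⟨k, hk⟩ => ⟨k + 1, layers_le_pred hB a k X hk⟩

lemma boundedLayers_shift {a n a' : ℤ} (h : n + a' = a) {X : DerivedCategory (ModuleCat.{u} R)}
    (hX : boundedLayers B a X) : boundedLayers B a' (X⟦n⟧) :=
  ⟨hX.choose, layers_shift h _ hX.choose_spec⟩

variable [IsNoetherianRing R]

lemma boundedLayers_ext₂ (hB : IsResolvingSubclass B) (a : ℤ)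
    {T : Triangle (DerivedCategory (ModuleCat.{u} R))} (hT : T ∈ distTriang _)
    (h₁ : boundedLayers B a T.obj₁) (h₃ : boundedLayers B a T.obj₃) :
    boundedLayers B a T.obj₂ := by
  obtain ⟨k, hk⟩ := h₁
  obtain ⟨j, hj⟩ := h₃
  exact ⟨max k j, extensionProduct_layers_le hB a (max k j) j (le_max_right _ _) _
    ⟨_, _, _, _, _, hT, layers_monotone hB a (le_max_left k j) _ hk, hj⟩⟩

lemma boundedLayers_ext₁ (hB : IsResolvingSubclass B) (a : ℤ)
    {T : Triangle (DerivedCategory (ModuleCat.{u} R))} (hT : T ∈ distTriang _)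
    (h₂ : boundedLayers B a T.obj₂) (h₃ : boundedLayers B a T.obj₃) :
    boundedLayers B a T.obj₁ := by
  -- The inverse shift moves the third vertex to degrees ≥ a + 1, so nothing is lost in this case.
  have h := boundedLayers_le_pred hB _ _ (boundedLayers_shift (n := -1) (a' := a + 1) (by lia) h₃)
  rw [add_sub_cancel_right] at h
  exact boundedLayers_ext₂ hB a (inv_rot_of_distTriang _ hT) h h₂

/-- The only source of the + 1 in the final estimate: the first vertex, shifted by 1, starts in
degree a - 1. -/
lemma boundedLayers_ext₃ (hB : IsResolvingSubclass B) (a : ℤ)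
    {T : Triangle (DerivedCategory (ModuleCat.{u} R))} (hT : T ∈ distTriang _)
    (h₁ : boundedLayers B a T.obj₁) (h₂ : boundedLayers B a T.obj₂) :
    boundedLayers B (a - 1) T.obj₃ :=
  boundedLayers_ext₂ hB (a - 1) (rot_of_distTriang _ hT) (boundedLayers_le_pred hB a _ h₂)
    (boundedLayers_shift (n := 1) (by lia) h₁)

end LayersTriangle

/-! ### Realization by complexes -/

section Realization

open DerivedCategory Pretriangulated ObjectProperty

variable {R : Type u} [CommRing R]

lemma isIso_cokernel_π_f_of_isZero {K L : CochainComplex (ModuleCat.{u} R) ℤ} (f : K ⟶ L) (i : ℤ)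
    (h : IsZero (K.X i)) : IsIso ((cokernel.π f).f i) := by
  have hex := (ShortComplex.exact_cokernel f).map (HomologicalComplex.eval _ _ i)
  have : Mono ((cokernel.π f).f i) := hex.mono_g (h.eq_of_src _ _)
  exact isIso_of_mono_of_epi _

lemma isZero_cokernel_X_of_isIso {K L : CochainComplex (ModuleCat.{u} R) ℤ} (f : K ⟶ L) (i : ℤ)
    [IsIso (f.f i)] : IsZero ((cokernel f).X i) := by
  have h : (cokernel.π f).f i = 0 := by
    rw [← cancel_epi (f.f i), ← HomologicalComplex.comp_f, cokernel.condition]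
    simp
  have : Epi ((cokernel.π f).f i) := inferInstance
  exact IsZero.of_epi_eq_zero _ h

lemma mappingCocone_X_iso_left {K L : CochainComplex (ModuleCat.{u} R) ℤ} (φ : K ⟶ L) (p q : ℤ)
    (hpq : p + -1 = q) (h : IsZero (L.X q)) :
    Nonempty ((CochainComplex.mappingCocone φ).X p ≅ K.X p) :=
  ⟨⟨(CochainComplex.mappingCocone.fst φ).f p, (CochainComplex.mappingCocone.inl φ).v p p _, by
    have := CochainComplex.mappingCocone.id_X φ p q hpq
    rwa [h.eq_of_tgt ((CochainComplex.mappingCocone.snd φ).v p q hpq) 0, zero_comp,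
      add_zero] at this, by simp⟩⟩

lemma mappingCocone_X_iso_right {K L : CochainComplex (ModuleCat.{u} R) ℤ} (φ : K ⟶ L) (p q : ℤ)
    (hpq : p + -1 = q) (h : IsZero (K.X p)) :
    Nonempty ((CochainComplex.mappingCocone φ).X p ≅ L.X q) :=
  ⟨⟨(CochainComplex.mappingCocone.snd φ).v p q hpq,
    (CochainComplex.mappingCocone.inr φ).1.v q p (by lia), by
    have := CochainComplex.mappingCocone.id_X φ p q hpq
    rwa [h.eq_of_tgt ((CochainComplex.mappingCocone.fst φ).f p) 0, zero_comp,
      zero_add] at this, by simp⟩⟩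

variable [HasDerivedCategory.{u + 1} (ModuleCat.{u} R)] {B : ObjectProperty (ModuleCat.{u} R)}

/-- Brutal truncation: the top entry is a subcomplex, and its cokernel is the same complex with that
entry removed. -/
lemma layers_Q_obj (hB : IsResolvingSubclass B) (a : ℤ) (k : ℕ)
    (K : CochainComplex (ModuleCat.{u} R) ℤ) (hK : ∀ i, B (K.X i))
    (hge : ∀ i < a, IsZero (K.X i)) (hle : ∀ i > a + k, IsZero (K.X i)) :
    layers B a k (Q.obj K) := by
  induction k generalizing K with
  | zero =>
    have : K.IsStrictlyGE a := (CochainComplex.isStrictlyGE_iff _ _).2 hge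
    have : K.IsStrictlyLE a := (CochainComplex.isStrictlyLE_iff _ _).2 (by simpa using hle)
    obtain ⟨M, ⟨e⟩⟩ := K.exists_iso_single a
    refine ⟨M, hB.of_iso ?_ (hK a), ⟨Q.mapIso e⟩⟩
    exact (HomologicalComplex.eval _ _ a).mapIso e ≪≫
      HomologicalComplex.singleObjXSelf (ComplexShape.up ℤ) a M
  | succ k ih =>
    let b := a + k + 1
    let φ : (HomologicalComplex.single _ (ComplexShape.up ℤ) b).obj (K.X b) ⟶ K :=
      HomologicalComplex.mkHomFromSingle (𝟙 _)
        (fun j hj => (hle j (by simp at hj; lia)).eq_of_tgt _ _)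
    have hb : IsIso (φ.f b) := by
      simp only [φ, HomologicalComplex.mkHomFromSingle_f]
      infer_instance
    have hφ (i : ℤ) (hi : i ≠ b) : IsZero
        (((HomologicalComplex.single _ (ComplexShape.up ℤ) b).obj (K.X b)).X i) :=
      HomologicalComplex.isZero_single_obj_X _ _ _ _ hi
    have : Mono φ := by
      have (i : ℤ) : Mono (φ.f i) := by
        by_cases hi : i = b
        · subst hi; infer_instance
        · exact ⟨fun _ _ _ => (hφ i hi).eq_of_tgt _ _⟩
      exact HomologicalComplex.mono_of_mono_f _ this
    have hS : (ShortComplex.mk φ (cokernel.π φ) (cokernel.condition φ)).ShortExact :=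
      ShortComplex.ShortExact.mk' (ShortComplex.exact_cokernel φ) inferInstance inferInstance
    have hiso (i : ℤ) (hi : i ≠ b) : Nonempty (K.X i ≅ (cokernel φ).X i) := by
      have := isIso_cokernel_π_f_of_isZero φ i (hφ i hi)
      exact ⟨asIso ((cokernel.π φ).f i)⟩
    refine ⟨_, _, _, _, _, triangleOfSES_distinguished hS,
      ⟨K.X b, hK b, ⟨Iso.refl _⟩⟩, ih _ (fun i => ?_) (fun i hi => ?_) (fun i hi => ?_)⟩
    · by_cases hi : i = b
      · subst hi; exact hB.of_isZero (isZero_cokernel_X_of_isIso φ _)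
      · exact hB.of_iso (hiso i hi).some (hK i)
    · exact (hge i hi).of_iso (hiso i (by lia)).some.symm
    · by_cases h : i = b
      · subst h; exact isZero_cokernel_X_of_isIso φ _
      · exact (hle i (by push_cast; lia)).of_iso (hiso i h).some.symm

/-- A morphism to a module in the top degree comes from a morphism of complexes. -/
lemma exists_Q_map_eq_of_isStrictlyLE {K : CochainComplex (ModuleCat.{u} R) ℤ} (n : ℤ)
    [K.IsStrictlyLE n] {M : ModuleCat.{u} R}
    (f : Q.obj K ⟶ Q.obj ((CochainComplex.singleFunctor _ n).obj M)) :
    ∃ g : K ⟶ (CochainComplex.singleFunctor _ n).obj M, Q.map g = f := by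
  -- The fraction can be chosen with middle object concentrated in degree n. Its denominator is then
  -- a quasi-isomorphism between modules in one degree, hence already invertible as a chain map.
  obtain ⟨Y, _, _, g, s, hs, rfl⟩ := left_fac_of_isStrictlyLE_of_isStrictlyGE n n f
  obtain ⟨A₀, ⟨e⟩⟩ : ∃ A₀, Nonempty (Y ≅ (CochainComplex.singleFunctor _ n).obj A₀) :=
    Y.exists_iso_single n
  obtain ⟨φ, hφ⟩ := (CochainComplex.singleFunctor _ n).map_surjective (s ≫ e.hom)
  have : IsIso ((singleFunctor (ModuleCat.{u} R) n).map φ) := by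
    change IsIso (Q.map ((CochainComplex.singleFunctor _ n).map φ))
    rw [hφ, Functor.map_comp]
    infer_instance
  have : IsIso φ := (NatIso.isIso_map_iff (singleFunctorCompHomologyFunctorIso _ n) φ).1
    (by dsimp; infer_instance)
  have : IsIso (s ≫ e.hom) := by rw [← hφ]; infer_instance
  have : IsIso s := IsIso.of_isIso_comp_right s e.hom
  exact ⟨g ≫ inv s, by simp⟩

/-- Objects in the same position of two distinguished triangles whose third morphisms are
isomorphic are isomorphic. -/
lemma nonempty_iso₁_of_distTriang {T T' : Triangle (DerivedCategory (ModuleCat.{u} R))}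
    (hT : T ∈ distTriang _) (hT' : T' ∈ distTriang _) (e₂ : T.obj₂ ≅ T'.obj₂)
    (e₃ : T.obj₃ ≅ T'.obj₃) (comm : T.mor₂ ≫ e₃.hom = e₂.hom ≫ T'.mor₂) :
    Nonempty (T.obj₁ ≅ T'.obj₁) := by
  obtain ⟨a, h₁, h₂⟩ := complete_distinguished_triangle_morphism₁ T T' hT hT' e₂.hom e₃.hom comm
  have : IsIso a := isIso₁_of_isIso₂₃ (Triangle.homMk T T' a e₂.hom e₃.hom h₁ comm h₂) hT hT'
    (inferInstanceAs (IsIso e₂.hom)) (inferInstanceAs (IsIso e₃.hom))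
  exact ⟨asIso a⟩

lemma exists_complex_of_layers (hB : IsResolvingSubclass B) (a : ℤ) (k : ℕ)
    {X : DerivedCategory (ModuleCat.{u} R)} (hX : layers B a k X) :
    ∃ K : CochainComplex (ModuleCat.{u} R) ℤ, (∀ i, B (K.X i)) ∧ (∀ i < a, IsZero (K.X i)) ∧
      (∀ i > a + k, IsZero (K.X i)) ∧ Nonempty (X ≅ Q.obj K) := by
  have hsingle {M : ModuleCat.{u} R} {n i : ℤ} (hi : i ≠ n) :
      IsZero (((CochainComplex.singleFunctor _ n).obj M).X i) :=
    HomologicalComplex.isZero_single_obj_X _ _ _ _ hi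
  have hself (M : ModuleCat.{u} R) (n : ℤ) :
      ((CochainComplex.singleFunctor _ n).obj M).X n ≅ M :=
    HomologicalComplex.singleObjXSelf (ComplexShape.up ℤ) n M
  induction k generalizing X with
  | zero =>
    obtain ⟨M, hM, ⟨e⟩⟩ := hX
    refine ⟨(CochainComplex.singleFunctor _ a).obj M, fun i => ?_, fun i hi => hsingle (by lia),
      fun i hi => hsingle (by simp at hi; lia), ⟨e⟩⟩
    by_cases hi : i = a
    · subst hi; exact hB.of_iso (hself M _).symm hM
    · exact hB.of_isZero (hsingle hi)
  | succ k ih =>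
    obtain ⟨Y, Z, f, g, h, hT, ⟨M, hM, ⟨e⟩⟩, hZ⟩ := hX
    obtain ⟨K, hK, hge, hle, ⟨eZ⟩⟩ := ih hZ
    have : K.IsStrictlyLE (a + k) := (CochainComplex.isStrictlyLE_iff _ _).2 hle
    let eY : Y⟦(1 : ℤ)⟧ ≅ Q.obj ((CochainComplex.singleFunctor _ (a + k)).obj M) :=
      (shiftFunctor _ (1 : ℤ)).mapIso e ≪≫
        ((singleFunctors (ModuleCat.{u} R)).shiftIso 1 (a + k) (a + k + 1) (by lia)).app M
    -- After the shift the new module sits in degree a + k, the top degree allowed for K, so the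
    -- connecting map lifts to a chain map. Its cocone represents X, and the cocone has the module
    -- in degree a + k + 1 and K elsewhere.
    obtain ⟨φ, hφ⟩ := exists_Q_map_eq_of_isStrictlyLE (a + k) (eZ.inv ≫ h ≫ eY.hom)
    have hX' := nonempty_iso₁_of_distTriang (rot_of_distTriang _ hT)
      (mappingCocone_triangle_distinguished φ) eZ eY (by
        change h ≫ eY.hom = eZ.hom ≫ Q.map φ
        rw [hφ, Iso.hom_inv_id_assoc])
    have hl {i : ℤ} (hi : i ≠ a + k + 1) :
        Nonempty ((CochainComplex.mappingCocone φ).X i ≅ K.X i) :=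
      mappingCocone_X_iso_left φ i (i - 1) rfl (hsingle (by lia))
    have hr : Nonempty ((CochainComplex.mappingCocone φ).X (a + k + 1) ≅ M) :=
      (mappingCocone_X_iso_right φ (a + k + 1) (a + k) (by lia) (hle _ (by lia))).map
        (· ≪≫ hself M _)
    refine ⟨CochainComplex.mappingCocone φ, fun i => ?_, fun i hi => ?_, fun i hi => ?_, hX'⟩
    · by_cases hi : i = a + k + 1
      · subst hi; exact hB.of_iso hr.some.symm hM
      · exact hB.of_iso (hl hi).some.symm (hK i)
    · exact (hge i hi).of_iso (hl (by lia)).some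
    · push_cast at hi
      exact (hle i (by lia)).of_iso (hl (by lia)).some

end Realization

/-! ### Comparison of chain complexes and cochain complexes -/

section ChainCochain

open DerivedCategory Pretriangulated ObjectProperty

variable {R : Type u} [CommRing R]

/-- A chain complex, viewed as a cochain complex. -/
abbrev toCochain (R : Type u) [CommRing R] :
    ChainComplex (ModuleCat.{u} R) ℤ ⥤ CochainComplex (ModuleCat.{u} R) ℤ :=
  (ChainComplex.cochainComplexEquivalence (ModuleCat.{u} R)).functor

/-- A cochain complex, viewed as a chain complex. -/
abbrev toChain (R : Type u) [CommRing R] :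
    CochainComplex (ModuleCat.{u} R) ℤ ⥤ ChainComplex (ModuleCat.{u} R) ℤ :=
  (ChainComplex.cochainComplexEquivalence (ModuleCat.{u} R)).inverse

lemma quasiIso_toCochain_map {X Y : ChainComplex (ModuleCat.{u} R) ℤ} (f : X ⟶ Y)
    (hf : QuasiIso f) : QuasiIso ((toCochain R).map f) := by
  refine ⟨fun n => ?_⟩
  rw [quasiIsoAt_iff' _ (n - 1) n (n + 1) (by simp) (by simp)]
  have := (quasiIsoAt_iff' f (-(n - 1)) (-n) (-(n + 1)) (by simp; lia) (by simp; lia)).1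
    (hf.quasiIsoAt (-n))
  exact this

lemma quasiIso_toChain_map {X Y : CochainComplex (ModuleCat.{u} R) ℤ} (f : X ⟶ Y)
    (hf : QuasiIso f) : QuasiIso ((toChain R).map f) := by
  refine ⟨fun n => ?_⟩
  rw [quasiIsoAt_iff' _ (n + 1) n (n - 1) (by simp) (by simp)]
  have := (quasiIsoAt_iff' f (-(n + 1)) (-n) (-(n - 1)) (by simp; lia) (by simp; lia)).1
    (hf.quasiIsoAt (-n))
  exact this

variable [HasDerivedCategory.{u + 1} (ModuleCat.{u} R)]

/-- An isomorphism in the derived category is a fraction whose denominator, and therefore also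
numerator, is a quasi-isomorphism; this is already a zigzag. -/
lemma quasiIsomorphic_iff_nonempty_iso (X Y : ChainComplex (ModuleCat.{u} R) ℤ) :
    QuasiIsomorphic X Y ↔
      Nonempty (Q.obj ((toCochain R).obj X) ≅ Q.obj ((toCochain R).obj Y)) := by
  constructor
  · intro h
    induction h with
    | rel A B h =>
      obtain ⟨α, hα⟩ := h
      have := quasiIso_toCochain_map α hα
      exact ⟨asIso (Q.map ((toCochain R).map α))⟩
    | refl A => exact ⟨Iso.refl _⟩
    | symm A B _ ih => exact ih.map Iso.symm
    | trans A B C _ _ ih₁ ih₂ => exact ⟨ih₁.some ≪≫ ih₂.some⟩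
  · rintro ⟨e⟩
    have hiso {A B : ChainComplex (ModuleCat.{u} R) ℤ} (i : A ≅ B) : QuasiIsomorphic A B :=
      .rel _ _ ⟨i.hom, inferInstance⟩
    obtain ⟨Z, g, s, hs, hg⟩ := left_fac e.hom
    have hg' : IsIso (Q.map g) := by
      have : Q.map g = e.hom ≫ Q.map s := by simp [hg]
      rw [this]; infer_instance
    rw [isIso_Q_map_iff_quasiIso] at hs hg'
    let E := ChainComplex.cochainComplexEquivalence (ModuleCat.{u} R)
    exact (hiso (E.unitIso.app X)).trans _ _ _
      (.trans _ _ _ (.rel _ _ ⟨_, quasiIso_toChain_map g hg'⟩)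
        (.trans _ _ _ (.symm _ _ (.rel _ _ ⟨_, quasiIso_toChain_map s hs⟩))
          (hiso (E.unitIso.app Y).symm)))

variable {B : ObjectProperty (ModuleCat.{u} R)}

/-- A complex has a `B`-resolution vanishing above degree `n` if and only if it is a finite
iterated extension of members of `B` placed in homological degrees `≤ n`. -/
lemma exists_isClassResolution_iff (hB : IsResolvingSubclass B)
    (X : ChainComplex (ModuleCat.{u} R) ℤ) (n : ℤ) :
    (∃ A, IsClassResolution B A X ∧ ∀ i > n, IsZero (A.X i)) ↔
      boundedLayers B (-n) (Q.obj ((toCochain R).obj X)) := by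
  constructor
  · rintro ⟨A, ⟨⟨m, hm⟩, hA, hAX⟩, hn⟩
    obtain ⟨e⟩ := (quasiIsomorphic_iff_nonempty_iso A X).1 hAX
    obtain ⟨k, hk⟩ : ∃ k : ℕ, n - m ≤ k := ⟨(n - m).toNat, Int.self_le_toNat _⟩
    refine ⟨k, prop_of_iso _ e (layers_Q_obj hB (-n) k _ (fun i => hA (-i)) (fun i hi => ?_)
      (fun i hi => ?_))⟩
    · exact hn (-i) (by lia)
    · exact hm (-i) (by lia)
  · rintro ⟨k, hk⟩
    obtain ⟨K, hK, hge, hle, ⟨e⟩⟩ := exists_complex_of_layers hB (-n) k hk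
    let E := ChainComplex.cochainComplexEquivalence (ModuleCat.{u} R)
    refine ⟨(toChain R).obj K, ⟨⟨n - k, fun i hi => hle (-i) (by lia)⟩, fun i => hK (-i), ?_⟩,
      fun i hi => hge (-i) (by lia)⟩
    rw [quasiIsomorphic_iff_nonempty_iso]
    exact ⟨Q.mapIso (E.counitIso.app K) ≪≫ e.symm⟩

end ChainCochain

/-! ### The dimension attached to a resolving subclass -/

section ClassDim

variable {R : Type u} [CommRing R] {B : ObjectProperty (ModuleCat.{u} R)}

lemma supDegree_le_iff (A : ChainComplex (ModuleCat.{u} R) ℤ) (n : ℤ) :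
    supDegree A ≤ ((n : ℝ) : EReal) ↔ ∀ i > n, IsZero (A.X i) := by
  simp only [supDegree, iSup_le_iff, EReal.coe_le_coe_iff, Int.cast_le]
  exact forall_congr' fun i => ⟨fun h hi => by_contra fun hz => hi.not_ge (h hz),
    fun h hz => not_lt.1 fun hi => hz (h hi)⟩

lemma classDim_le_of_exists {X : ChainComplex (ModuleCat.{u} R) ℤ} {n : ℤ}
    (h : ∃ A, IsClassResolution B A X ∧ ∀ i > n, IsZero (A.X i)) :
    classDim B X ≤ ((n : ℝ) : EReal) := by
  obtain ⟨A, hA, hn⟩ := h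
  exact (iInf₂_le A hA).trans ((supDegree_le_iff A n).2 hn)

lemma exists_of_classDim_lt {X : ChainComplex (ModuleCat.{u} R) ℤ} {n : ℤ}
    (h : classDim B X < (((n + 1 : ℤ) : ℝ) : EReal)) :
    ∃ A, IsClassResolution B A X ∧ ∀ i > n, IsZero (A.X i) := by
  simp only [classDim, iInf_lt_iff] at h
  obtain ⟨A, hA, h⟩ := h
  refine ⟨A, hA, fun i hi => by_contra fun hz => h.not_ge ?_⟩
  refine le_trans ?_ (le_iSup₂ (f := fun (i : ℤ) (_ : ¬ IsZero (A.X i)) => ((i : ℝ) : EReal)) i hz)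
  exact_mod_cast hi

lemma classDim_le_max_add_one {X Y Z : ChainComplex (ModuleCat.{u} R) ℤ}
    (h : ∀ n : ℤ, (∃ A, IsClassResolution B A X ∧ ∀ i > n, IsZero (A.X i)) →
      (∃ A, IsClassResolution B A Y ∧ ∀ i > n, IsZero (A.X i)) →
      ∃ A, IsClassResolution B A Z ∧ ∀ i > n + 1, IsZero (A.X i)) :
    classDim B Z ≤ max (classDim B X) (classDim B Y) + 1 := by
  have key (n : ℤ) (hn : max (classDim B X) (classDim B Y) < (((n + 1 : ℤ) : ℝ) : EReal)) :
      classDim B Z ≤ (((n + 1 : ℤ) : ℝ) : EReal) :=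
    classDim_le_of_exists (h n (exists_of_classDim_lt ((le_max_left _ _).trans_lt hn))
      (exists_of_classDim_lt ((le_max_right _ _).trans_lt hn)))
  generalize max (classDim B X) (classDim B Y) = c at key
  induction c with
  | top => exact le_top.trans_eq (EReal.top_add_coe 1).symm
  | bot =>
    rw [EReal.bot_add, le_bot_iff, EReal.eq_bot_iff_forall_lt]
    intro y
    -- The choice n = ⌊y⌋ - 2 gives the bound n + 1 = ⌊y⌋ - 1, strictly below y.
    refine (key (⌊y⌋ - 2) (EReal.bot_lt_coe _)).trans_lt ?_
    rw [EReal.coe_lt_coe_iff]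
    push_cast
    linarith [Int.floor_le y]
  | coe c =>
    refine (key ⌊c⌋ ?_).trans ?_
    · rw [EReal.coe_lt_coe_iff]
      push_cast
      exact Int.lt_floor_add_one c
    · rw [← EReal.coe_one, ← EReal.coe_add, EReal.coe_le_coe_iff]
      push_cast
      linarith [Int.floor_le c]

open DerivedCategory in
theorem classDim_le_of_shortExact [IsNoetherianRing R] (hB : IsResolvingSubclass B)
    (X : Fin 3 → ChainComplex (ModuleCat.{u} R) ℤ)
    (f : X 0 ⟶ X 1) (g : X 1 ⟶ X 2) (w : f ≫ g = 0) (hX : (ShortComplex.mk f g w).ShortExact)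
    (i j k : Fin 3) (hijk : ({i, j, k} : Set (Fin 3)) = Set.univ) :
    classDim B (X k) ≤ max (classDim B (X i)) (classDim B (X j)) + 1 := by
  have := HasDerivedCategory.standard (ModuleCat.{u} R)
  refine classDim_le_max_add_one fun n hi hj => ?_
  rw [exists_isClassResolution_iff hB] at hi hj ⊢
  have hT := triangleOfSES_distinguished (hX.map_of_exact (toCochain R))
  have h₁ := boundedLayers_ext₁ hB (-n) hT
  have h₂ := boundedLayers_ext₂ hB (-n) hT
  have h₃ := boundedLayers_ext₃ hB (-n) hT
  have hle := boundedLayers_le_pred hB (-n)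
  rw [show -(n + 1) = -n - 1 by ring]
  have hmem (t : Fin 3) : t = i ∨ t = j ∨ t = k := by
    have : t ∈ ({i, j, k} : Set (Fin 3)) := hijk ▸ Set.mem_univ t
    simpa using this
  have hall (t : Fin 3) (ht : t ≠ k) :
      boundedLayers B (-n) (Q.obj ((toCochain R).obj (X t))) := by
    rcases hmem t with rfl | rfl | rfl
    · exact hi
    · exact hj
    · exact absurd rfl ht
  fin_cases k
  · exact hle _ (h₁ (hall 1 (by decide)) (hall 2 (by decide)))
  · exact hle _ (h₂ (hall 0 (by decide)) (hall 2 (by decide)))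
  · exact h₃ (hall 0 (by decide)) (hall 1 (by decide))

theorem classDim_lt_top_of_shortExact [IsNoetherianRing R] (hB : IsResolvingSubclass B)
    (X : Fin 3 → ChainComplex (ModuleCat.{u} R) ℤ)
    (f : X 0 ⟶ X 1) (g : X 1 ⟶ X 2) (w : f ≫ g = 0) (hX : (ShortComplex.mk f g w).ShortExact)
    (i j k : Fin 3) (hijk : ({i, j, k} : Set (Fin 3)) = Set.univ)
    (hi : classDim B (X i) < ⊤) (hj : classDim B (X j) < ⊤) : classDim B (X k) < ⊤ :=
  (classDim_le_of_shortExact hB X f g w hX i j k hijk).trans_lt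
    (EReal.add_lt_top (max_lt hi hj).ne (EReal.coe_ne_top 1))

end ClassDim

/-! ### Vanishing of `Ext` in short exact sequences -/

section ExtVanishing

open Abelian

variable {R : Type u} [CommRing R] {S : ShortComplex (ModuleCat.{u} R)} (hS : S.ShortExact)
  (Y : ModuleCat.{u} R)

include hS

lemma subsingleton_ext_X₂ (n : ℕ) (h₁ : Subsingleton (Ext S.X₁ Y n))
    (h₃ : Subsingleton (Ext S.X₃ Y n)) : Subsingleton (Ext S.X₂ Y n) := by
  refine subsingleton_of_forall_eq 0 fun x => ?_
  obtain ⟨y, rfl⟩ := Ext.contravariant_sequence_exact₂ hS _ x (Subsingleton.elim _ _)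
  rw [Subsingleton.elim y 0, Ext.comp_zero]

lemma subsingleton_ext_X₁ (n : ℕ) (h₂ : Subsingleton (Ext S.X₂ Y n))
    (h₃ : Subsingleton (Ext S.X₃ Y (1 + n))) : Subsingleton (Ext S.X₁ Y n) := by
  refine subsingleton_of_forall_eq 0 fun x => ?_
  obtain ⟨y, rfl⟩ := Ext.contravariant_sequence_exact₁ hS _ x rfl (Subsingleton.elim _ _)
  rw [Subsingleton.elim y 0, Ext.comp_zero]

lemma subsingleton_ext_X₃ (n : ℕ) (h₂ : Subsingleton (Ext S.X₂ Y (1 + n)))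
    (h₁ : Subsingleton (Ext S.X₁ Y n)) : Subsingleton (Ext S.X₃ Y (1 + n)) := by
  refine subsingleton_of_forall_eq 0 fun x => ?_
  obtain ⟨y, rfl⟩ := Ext.contravariant_sequence_exact₃ hS _ x (Subsingleton.elim _ _) rfl
  rw [Subsingleton.elim y 0, Ext.comp_zero]

/-- If every map `X₁ ⟶ Y` extends to `X₂`, then `Ext¹(X₃, Y)` embeds in `Ext¹(X₂, Y)`. -/
lemma subsingleton_ext_X₃_one (h₂ : Subsingleton (Ext S.X₂ Y 1))
    (h : ∀ φ : S.X₁ ⟶ Y, ∃ ψ : S.X₂ ⟶ Y, S.f ≫ ψ = φ) : Subsingleton (Ext S.X₃ Y 1) := by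
  refine subsingleton_of_forall_eq 0 fun x => ?_
  obtain ⟨y, rfl⟩ := Ext.contravariant_sequence_exact₃ hS _ x (Subsingleton.elim _ _) (add_zero 1)
  obtain ⟨ψ, hψ⟩ := h (Ext.homEquiv₀ y)
  -- The connecting map kills any map that factors through `S.f`.
  rw [← Ext.mk₀_homEquiv₀_apply y, ← hψ, ← Ext.mk₀_comp_mk₀, hS.extClass_comp_assoc]

lemma exists_extension_of_subsingleton_ext (h : Subsingleton (Ext S.X₃ Y 1)) (φ : S.X₁ ⟶ Y) :
    ∃ ψ : S.X₂ ⟶ Y, S.f ≫ ψ = φ := by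
  obtain ⟨x, hx⟩ := Ext.contravariant_sequence_exact₁ hS _ (Ext.mk₀ φ) (add_zero 1)
    (Subsingleton.elim _ _)
  refine ⟨Ext.homEquiv₀ x, (Ext.mk₀_bijective _ _).1 ?_⟩
  rw [← Ext.mk₀_comp_mk₀, Ext.mk₀_homEquiv₀_apply, hx]

omit hS in
lemma subsingleton_ext_of_retract {M N : ModuleCat.{u} R} (i : N ⟶ M) (r : M ⟶ N)
    (h : i ≫ r = 𝟙 N) (n : ℕ) (hM : Subsingleton (Ext M Y n)) : Subsingleton (Ext N Y n) := by
  refine subsingleton_of_forall_eq 0 fun x => ?_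
  rw [← Ext.mk₀_id_comp x, ← h, ← Ext.mk₀_comp_mk₀_assoc,
    Subsingleton.elim ((Ext.mk₀ r).comp x (zero_add n)) 0, Ext.comp_zero]

end ExtVanishing

/-! ### Totally reflexive modules -/

section TotallyReflexive

open Abelian

variable {R : Type u} [CommRing R]

/-- The dual of a short complex of modules. -/
def dualShortComplex (S : ShortComplex (ModuleCat.{u} R)) : ShortComplex (ModuleCat.{u} R) where
  X₁ := ModuleCat.of R (Module.Dual R S.X₃)
  X₂ := ModuleCat.of R (Module.Dual R S.X₂)
  X₃ := ModuleCat.of R (Module.Dual R S.X₁)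
  f := ModuleCat.ofHom S.g.hom.dualMap
  g := ModuleCat.ofHom S.f.hom.dualMap
  zero := by
    ext φ x
    change φ (S.g.hom (S.f.hom x)) = 0
    simp

lemma LinearMap.exists_comp_eq_of_ker_le_ker {M N P : Type*} [AddCommGroup M] [AddCommGroup N]
    [AddCommGroup P] [Module R M] [Module R N] [Module R P] (g : M →ₗ[R] N)
    (hg : Function.Surjective g) (φ : M →ₗ[R] P) (h : LinearMap.ker g ≤ LinearMap.ker φ) :
    ∃ ψ : N →ₗ[R] P, ψ ∘ₗ g = φ := by
  refine ⟨(LinearMap.ker g).liftQ φ h ∘ₗ (g.quotKerEquivOfSurjective hg).symm, ?_⟩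
  ext x
  have : (g.quotKerEquivOfSurjective hg).symm (g x) = (LinearMap.ker g).mkQ x := by
    rw [LinearEquiv.symm_apply_eq]; rfl
  simp [this]

/-- Vanishing of Ext¹ is needed only for surjectivity of restriction to the submodule; the rest is
left exactness of Hom. -/
lemma shortExact_dualShortComplex {S : ShortComplex (ModuleCat.{u} R)} (hS : S.ShortExact)
    (h : Subsingleton (Ext S.X₃ (ModuleCat.of R R) 1)) : (dualShortComplex S).ShortExact := by
  refine ModuleCat.shortComplex_shortExact _ (fun φ => ⟨fun hφ => ?_, ?_⟩) ?_ fun φ => ?_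
  · change S.f.hom.dualMap φ = 0 at hφ
    have hker : LinearMap.ker S.g.hom ≤ LinearMap.ker φ := by
      rw [← hS.exact.moduleCat_range_eq_ker]
      rintro _ ⟨y, rfl⟩
      exact LinearMap.congr_fun hφ y
    exact S.g.hom.exists_comp_eq_of_ker_le_ker hS.moduleCat_surjective_g φ hker
  · rintro ⟨ψ, rfl⟩
    exact congrArg (fun q => q.hom ψ) (dualShortComplex S).zero
  · exact LinearMap.dualMap_injective_of_surjective hS.moduleCat_surjective_g
  · obtain ⟨ψ, hψ⟩ := exists_extension_of_subsingleton_ext hS _ h (ModuleCat.ofHom φ)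
    exact ⟨ψ.hom, congrArg ModuleCat.Hom.hom hψ⟩

lemma IsTotallyReflexive.of_projective (P : ModuleCat.{u} R) [Module.Finite R P]
    [Module.Projective R P] : IsTotallyReflexive P where
  finite := inferInstance
  reflexive := inferInstance
  ext_eq_zero i hi := by
    obtain ⟨i, rfl⟩ := Nat.exists_eq_succ_of_ne_zero hi.ne'
    have : Projective P := (IsProjective.iff_projective (R := R) P).1 inferInstance
    exact Ext.subsingleton_of_projective _ _ _
  ext_dual_eq_zero i hi := by
    obtain ⟨i, rfl⟩ := Nat.exists_eq_succ_of_ne_zero hi.ne'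
    have : Projective (ModuleCat.of R (Module.Dual R P)) :=
      (IsProjective.iff_projective (R := R) (Module.Dual R P)).1 inferInstance
    exact Ext.subsingleton_of_projective _ _ _

lemma IsTotallyReflexive.of_retract {M N : ModuleCat.{u} R} (i : N ⟶ M) (r : M ⟶ N)
    (h : i ≫ r = 𝟙 N) (hM : IsTotallyReflexive M) : IsTotallyReflexive N := by
  have h' : r.hom ∘ₗ i.hom = LinearMap.id := congrArg ModuleCat.Hom.hom h
  have := hM.finite
  have := hM.reflexive
  have hr : Function.Surjective r.hom := fun x => ⟨i.hom x, LinearMap.congr_fun h' x⟩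
  refine ⟨Module.Finite.of_surjective r.hom hr, .of_split i.hom r.hom h',
    fun n hn => subsingleton_ext_of_retract _ i r h n (hM.ext_eq_zero n hn),
    fun n hn => subsingleton_ext_of_retract _ (ModuleCat.ofHom r.hom.dualMap)
      (ModuleCat.ofHom i.hom.dualMap) ?_ n (hM.ext_dual_eq_zero n hn)⟩
  ext φ x
  exact congrArg φ (LinearMap.congr_fun h' x)

section Extension

variable {S : ShortComplex (ModuleCat.{u} R)}

open Module.Dual in
lemma IsTotallyReflexive.X₂_of_shortExact (hS : S.ShortExact) (hf : Module.Finite R S.X₂)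
    (h₁ : IsTotallyReflexive S.X₁) (h₃ : IsTotallyReflexive S.X₃) :
    IsTotallyReflexive S.X₂ := by
  have hD := shortExact_dualShortComplex hS (h₃.ext_eq_zero 1 one_pos)
  have hres := hD.moduleCat_surjective_g
  have hgsurj := hS.moduleCat_surjective_g
  have hex := (ShortComplex.ShortExact.moduleCat_exact_iff_function_exact _).1 hS.exact
  have hDex := (ShortComplex.ShortExact.moduleCat_exact_iff_function_exact _).1 hD.exact
  have r₁ := h₁.reflexive.bijective_dual_eval'
  have r₃ := h₃.reflexive.bijective_dual_eval'
  refine ⟨hf, ⟨⟨?_, fun Φ => ?_⟩⟩,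
    fun n hn => subsingleton_ext_X₂ hS _ n (h₁.ext_eq_zero n hn) (h₃.ext_eq_zero n hn),
    fun n hn => subsingleton_ext_X₂ hD _ n (h₃.ext_dual_eq_zero n hn) (h₁.ext_dual_eq_zero n hn)⟩
  · refine (injective_iff_map_eq_zero _).2 fun m hm => ?_
    have hgm : S.g.hom m = 0 := r₃.1 <| by
      ext ψ
      simpa using LinearMap.congr_fun hm (S.g.hom.dualMap ψ)
    obtain ⟨l, rfl⟩ := (hex m).1 hgm
    have hl : l = 0 := r₁.1 <| by
      rw [map_zero]
      ext φ
      obtain ⟨ψ, rfl⟩ := hres φ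
      exact LinearMap.congr_fun hm ψ
    simp [hl]
  -- On functionals pulled back from X₃, Φ is evaluation at some g(m). So Φ minus evaluation at m
  -- factors through the dual of X₁, where it is evaluation at some l, and Φ is evaluation at m +
  -- f(l).
  · obtain ⟨n, hn⟩ := r₃.2 (Φ ∘ₗ S.g.hom.dualMap)
    obtain ⟨m, rfl⟩ := hgsurj n
    have hker : LinearMap.ker S.f.hom.dualMap ≤ LinearMap.ker (Φ - eval R S.X₂ m) := by
      intro φ hφ
      obtain ⟨ψ, rfl⟩ := (hDex φ).1 hφ
      have := LinearMap.congr_fun hn ψ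
      exact sub_eq_zero.2 this.symm
    obtain ⟨χ, hχ⟩ : ∃ χ : Module.Dual R (Module.Dual R S.X₁),
        χ ∘ₗ S.f.hom.dualMap = Φ - eval R S.X₂ m :=
      S.f.hom.dualMap.exists_comp_eq_of_ker_le_ker hres _ hker
    obtain ⟨l, rfl⟩ := r₁.2 χ
    refine ⟨m + S.f.hom l, ?_⟩
    have : eval R S.X₂ (S.f.hom l) = Φ - eval R S.X₂ m := by
      rw [← hχ]; rfl
    rw [map_add, this, add_sub_cancel]

open Module.Dual in
lemma IsTotallyReflexive.X₁_of_shortExact (hS : S.ShortExact) (hf : Module.Finite R S.X₁)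
    (h₂ : IsTotallyReflexive S.X₂) (h₃ : IsTotallyReflexive S.X₃) :
    IsTotallyReflexive S.X₁ := by
  have hD := shortExact_dualShortComplex hS (h₃.ext_eq_zero 1 one_pos)
  have hres := hD.moduleCat_surjective_g
  have hgsurj := hS.moduleCat_surjective_g
  have hex := (ShortComplex.ShortExact.moduleCat_exact_iff_function_exact _).1 hS.exact
  have r₂ := h₂.reflexive.bijective_dual_eval'
  have r₃ := h₃.reflexive.bijective_dual_eval'
  refine ⟨hf, ⟨⟨?_, fun χ => ?_⟩⟩, fun n hn => subsingleton_ext_X₁ hS _ n (h₂.ext_eq_zero n hn)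
    (h₃.ext_eq_zero (1 + n) (by lia)), fun n hn => ?_⟩
  · refine (injective_iff_map_eq_zero _).2 fun l hl => ?_
    have : S.f.hom l = 0 := r₂.1 <| by
      ext ψ
      simpa using LinearMap.congr_fun hl (S.f.hom.dualMap ψ)
    exact hS.moduleCat_injective_f (by simpa using this)
  · obtain ⟨m, hm⟩ := r₂.2 (χ ∘ₗ S.f.hom.dualMap)
    have hgm : S.g.hom m = 0 := r₃.1 <| by
      rw [map_zero]
      ext ψ
      have h0 : S.f.hom.dualMap (S.g.hom.dualMap ψ) = 0 :=
        congrArg (fun q => q.hom ψ) (dualShortComplex S).zero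
      have := LinearMap.congr_fun hm (S.g.hom.dualMap ψ)
      rw [LinearMap.comp_apply, h0, map_zero] at this
      exact this
    obtain ⟨l, rfl⟩ := (hex m).1 hgm
    refine ⟨l, ?_⟩
    ext φ
    obtain ⟨ψ, rfl⟩ := hres φ
    exact LinearMap.congr_fun hm ψ
  · obtain ⟨n, rfl⟩ := Nat.exists_eq_add_of_le hn
    rcases Nat.eq_zero_or_pos n with rfl | hn'
    -- Degree 1 is special, as Hom(X₃*, R) is nonzero in general. By reflexivity a functional on X₃*
    -- is evaluation at some g(m), and it extends to X₂* as evaluation at m.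
    · refine subsingleton_ext_X₃_one hD _ (h₂.ext_dual_eq_zero 1 one_pos) fun φ => ?_
      obtain ⟨n, hn⟩ := r₃.2 φ.hom
      obtain ⟨m, rfl⟩ := hgsurj n
      refine ⟨ModuleCat.ofHom (eval R S.X₂ m), ?_⟩
      ext ψ
      exact LinearMap.congr_fun hn ψ
    · exact subsingleton_ext_X₃ hD _ n (h₂.ext_dual_eq_zero _ (by lia))
        (h₃.ext_dual_eq_zero n hn')

end Extension

end TotallyReflexive

/-! ### Existence of minimal free resolutions -/

section MinimalResolution

variable {A : Type u} [CommRing A]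

lemma pi_mem_smul_top_of_forall_mem {n : ℕ} (I : Ideal A) (x : Fin n → A) (h : ∀ i, x i ∈ I) :
    x ∈ I • (⊤ : Submodule A (Fin n → A)) := by
  rw [pi_eq_sum_univ x]
  exact Submodule.sum_mem _ fun i _ => Submodule.smul_mem_smul (h i) Submodule.mem_top

variable [IsLocalRing A]

/-- A finite module over a local ring has a minimal free cover. -/
lemma exists_minimal_cover (M : Type u) [AddCommGroup M] [Module A M] [Module.Finite A M] :
    ∃ (n : ℕ) (p : (Fin n → A) →ₗ[A] M), Function.Surjective p ∧
      LinearMap.ker p ≤ IsLocalRing.maximalIdeal A • ⊤ := by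
  let m := IsLocalRing.maximalIdeal A
  let N := (m • ⊤ : Submodule A M)
  let _ : Field (A ⧸ m) := Ideal.Quotient.field m
  have : Module.Finite (A ⧸ m) (M ⧸ N) := Module.Finite.of_restrictScalars_finite A _ _
  let b := Module.finBasis (A ⧸ m) (M ⧸ N)
  choose v hv using fun i => N.mkQ_surjective (b i)
  have hp (x : Fin (Module.finrank (A ⧸ m) (M ⧸ N)) → A) :
      N.mkQ (Fintype.linearCombination A v x) = ∑ i, Ideal.Quotient.mk m (x i) • b i := by
    simp only [Fintype.linearCombination_apply, map_sum, map_smul, hv]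
    rfl
  refine ⟨_, Fintype.linearCombination A v, ?_, fun x hx => ?_⟩
  -- Nakayama: surjectivity may be checked modulo the maximal ideal, where the chosen lifts become a
  -- basis.
  · rw [← LinearMap.range_eq_top, ← IsLocalRing.map_mkQ_eq_top, eq_top_iff]
    rintro y -
    choose x hx using fun i => Ideal.Quotient.mk_surjective (I := m) (b.repr y i)
    refine ⟨Fintype.linearCombination A v x, ⟨x, rfl⟩, ?_⟩
    refine (hp x).trans ?_
    simp only [hx]
    exact b.sum_repr y
  · refine pi_mem_smul_top_of_forall_mem _ _ fun i => ?_
    rw [← Ideal.Quotient.eq_zero_iff_mem]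
    refine Fintype.linearIndependent_iff.1 b.linearIndependent (fun i => Ideal.Quotient.mk m (x i))
      ?_ i
    rw [← hp, LinearMap.mem_ker.1 hx, map_zero]

/-- The rank of a minimal free cover. -/
def coverRank (M : {M : ModuleCat.{u} A // Module.Finite A M}) : ℕ :=
  have := M.2
  (exists_minimal_cover (A := A) M.1).choose

/-- A minimal free cover. -/
def cover (M : {M : ModuleCat.{u} A // Module.Finite A M}) : (Fin (coverRank M) → A) →ₗ[A] M.1 :=
  have := M.2
  (exists_minimal_cover (A := A) M.1).choose_spec.choose

lemma cover_surjective (M : {M : ModuleCat.{u} A // Module.Finite A M}) :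
    Function.Surjective (cover M) :=
  have := M.2
  (exists_minimal_cover (A := A) M.1).choose_spec.choose_spec.1

lemma ker_cover_le (M : {M : ModuleCat.{u} A // Module.Finite A M}) :
    LinearMap.ker (cover M) ≤ IsLocalRing.maximalIdeal A • ⊤ :=
  have := M.2
  (exists_minimal_cover (A := A) M.1).choose_spec.choose_spec.2

variable [IsNoetherianRing A]

/-- The iterated syzygies of a finite module. -/
def minimalSyzygy (M : {M : ModuleCat.{u} A // Module.Finite A M}) :
    ℕ → {M : ModuleCat.{u} A // Module.Finite A M}
  | 0 => M
  | n + 1 => ⟨ModuleCat.of A (LinearMap.ker (cover (minimalSyzygy M n))),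
      inferInstanceAs (Module.Finite A (LinearMap.ker (cover (minimalSyzygy M n))))⟩

variable (M : {M : ModuleCat.{u} A // Module.Finite A M})

/-- The differential of the minimal free resolution. -/
def minimalDifferential (n : ℕ) : ModuleCat.of A (Fin (coverRank (minimalSyzygy M (n + 1))) → A) ⟶
    ModuleCat.of A (Fin (coverRank (minimalSyzygy M n)) → A) :=
  ModuleCat.ofHom ((LinearMap.ker (cover (minimalSyzygy M n))).subtype ∘ₗ
    cover (minimalSyzygy M (n + 1)))

lemma range_minimalDifferential (n : ℕ) :
    LinearMap.range (minimalDifferential M n).hom = LinearMap.ker (cover (minimalSyzygy M n)) := by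
  refine (LinearMap.range_comp_of_range_eq_top _
    (LinearMap.range_eq_top.2 (cover_surjective (minimalSyzygy M (n + 1))))).trans ?_
  exact Submodule.range_subtype _

lemma ker_minimalDifferential (n : ℕ) :
    LinearMap.ker (minimalDifferential M n).hom =
      LinearMap.ker (cover (minimalSyzygy M (n + 1))) :=
  LinearMap.ker_comp_of_ker_eq_bot _ (Submodule.ker_subtype _)

lemma exact_minimalDifferential (n : ℕ) :
    LinearMap.range (minimalDifferential M (n + 1)).hom =
      LinearMap.ker (minimalDifferential M n).hom := by
  rw [range_minimalDifferential, ker_minimalDifferential]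

lemma minimalDifferential_comp (n : ℕ) :
    minimalDifferential M (n + 1) ≫ minimalDifferential M n = 0 := by
  refine ModuleCat.hom_ext (LinearMap.ext fun x => ?_)
  have : (minimalDifferential M (n + 1)).hom x ∈ LinearMap.ker (minimalDifferential M n).hom :=
    exact_minimalDifferential M n ▸ LinearMap.mem_range_self _ x
  exact this

/-- The minimal free resolution, as a complex. -/
def minimalComplex : ChainComplex (ModuleCat.{u} A) ℕ :=
  ChainComplex.of (fun n => ModuleCat.of A (Fin (coverRank (minimalSyzygy M n)) → A))
    (minimalDifferential M) (minimalDifferential_comp M)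

lemma minimalComplex_d (n : ℕ) : (minimalComplex M).d (n + 1) n = minimalDifferential M n :=
  by
  simp [minimalComplex]

lemma minimalComplex_exactAt_succ (n : ℕ) : (minimalComplex M).ExactAt (n + 1) := by
  rw [HomologicalComplex.exactAt_iff' _ (n + 1 + 1) (n + 1) n (by simp) (by simp)]
  rw [ShortComplex.moduleCat_exact_iff_range_eq_ker]
  change LinearMap.range ((minimalComplex M).d (n + 1 + 1) (n + 1)).hom =
    LinearMap.ker ((minimalComplex M).d (n + 1) n).hom
  rw [minimalComplex_d, minimalComplex_d]
  exact exact_minimalDifferential M n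

lemma minimalDifferential_comp_cover :
    minimalDifferential M 0 ≫ ModuleCat.ofHom (cover M) = 0 := by
  refine ModuleCat.hom_ext (LinearMap.ext fun x => ?_)
  have : (minimalDifferential M 0).hom x ∈ LinearMap.ker (cover M) :=
    range_minimalDifferential M 0 ▸ LinearMap.mem_range_self _ x
  exact this

/-- The minimal free resolution of a finite module over a Noetherian local ring. -/
def minimalResolution : ProjectiveResolution M.1 where
  complex := minimalComplex M
  projective n := (IsProjective.iff_projective (R := A)
    (Fin (coverRank (minimalSyzygy M n)) → A)).1 inferInstance
  π := (ChainComplex.toSingle₀Equiv _ _).symm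
    ⟨ModuleCat.ofHom (cover M), by
      rw [minimalComplex_d]; exact minimalDifferential_comp_cover M⟩
  quasiIso := ⟨fun n => by
    cases n
    · rw [ChainComplex.quasiIsoAt₀_iff, ShortComplex.quasiIso_iff_of_zeros']
      · have hex : (ShortComplex.mk _ _ (minimalDifferential_comp_cover M)).Exact := by
          rw [ShortComplex.moduleCat_exact_iff_range_eq_ker]
          exact range_minimalDifferential M 0
        have hepi : Epi (ModuleCat.ofHom (cover M)) :=
          (ModuleCat.epi_iff_surjective _).2 (cover_surjective M)
        refine (ShortComplex.exact_and_epi_g_iff_of_iso ?_).2 ⟨hex, hepi⟩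
        exact ShortComplex.isoMk (Iso.refl _) (Iso.refl _) (Iso.refl _)
          (by simp [minimalComplex]; rfl) (by simp; rfl)
      all_goals rfl
    · rw [quasiIsoAt_iff_exactAt']
      · apply minimalComplex_exactAt_succ
      · apply ChainComplex.exactAt_succ_single_obj⟩

lemma isMinimalFreeResolution_minimalResolution :
    IsMinimalFreeResolution (minimalResolution M) := by
  refine ⟨fun n => ⟨inferInstanceAs (Module.Finite A (Fin _ → A)),
    inferInstanceAs (Module.Free A (Fin _ → A))⟩, fun n => ?_⟩
  change LinearMap.range ((minimalComplex M).d (n + 1) n).hom ≤ _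
  rw [minimalComplex_d]
  exact (range_minimalDifferential M n).trans_le (ker_cover_le _)

end MinimalResolution

/-! ### Betti numbers as lengths of `Ext` modules -/

section BettiExt

open Abelian

lemma Module.length_le_add_of_ker_le_range {A : Type*} [CommRing A] {M N P : Type*}
    [AddCommGroup M] [AddCommGroup N] [AddCommGroup P]
    [Module A M] [Module A N] [Module A P] (f : M →ₗ[A] N) (g : N →ₗ[A] P)
    (h : LinearMap.ker g ≤ LinearMap.range f) :
    Module.length A N ≤ Module.length A M + Module.length A P := by
  rw [Module.length_eq_add_of_exact (LinearMap.ker g).subtype g.rangeRestrict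
    (Submodule.subtype_injective _) g.surjective_rangeRestrict
    (by rw [LinearMap.exact_iff, LinearMap.ker_rangeRestrict, Submodule.range_subtype])]
  refine add_le_add ?_ (Module.length_le_of_injective (LinearMap.range g).subtype
    (Submodule.subtype_injective _))
  exact (Module.length_le_of_injective (Submodule.inclusion h) (Submodule.inclusion_injective h)).trans
    (Module.length_le_of_surjective f.rangeRestrict f.surjective_rangeRestrict)

variable {A : Type u} [CommRing A] [IsLocalRing A]

/-- The residue field, as a module. -/
abbrev residueModule (A : Type u) [CommRing A] [IsLocalRing A] : ModuleCat.{u} A :=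
  ModuleCat.of A (IsLocalRing.ResidueField A)

lemma smul_top_le_ker_of_residueModule {F : ModuleCat.{u} A} (f : F ⟶ residueModule A) :
    IsLocalRing.maximalIdeal A • (⊤ : Submodule A F) ≤ LinearMap.ker f.hom := by
  refine Submodule.smul_le.2 fun a ha x _ => ?_
  rw [LinearMap.mem_ker, map_smul]
  change a • (show IsLocalRing.ResidueField A from f.hom x) = 0
  rw [Algebra.smul_def, IsLocalRing.ResidueField.algebraMap_eq,
    (IsLocalRing.residue_eq_zero_iff a).2 ha, zero_mul]

lemma IsMinimalFreeResolution.d_comp {M : ModuleCat.{u} A} {F : ProjectiveResolution M}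
    (hF : IsMinimalFreeResolution F) (n : ℕ) (f : F.complex.X n ⟶ residueModule A) :
    F.complex.d (n + 1) n ≫ f = 0 :=
  ModuleCat.hom_ext (LinearMap.ext fun x => smul_top_le_ker_of_residueModule f
    (hF.2 n (LinearMap.mem_range_self _ x)))

/-- The `Ext` modules into the residue field are read off from a minimal free resolution. -/
def IsMinimalFreeResolution.extLinearMap {M : ModuleCat.{u} A} {F : ProjectiveResolution M}
    (hF : IsMinimalFreeResolution F) (n : ℕ) :
    (F.complex.X n ⟶ residueModule A) →ₗ[A] Ext M (residueModule A) n where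
  toFun f := F.extMk f (n + 1) rfl (hF.d_comp n f)
  map_add' f g := (F.add_extMk f g (n + 1) rfl (hF.d_comp n f) (hF.d_comp n g)).symm
  map_smul' r f := by
    rw [RingHom.id_apply, Ext.smul_eq_comp_mk₀, F.extMk_comp_mk₀]
    simp

/-- Minimality makes every differential of Hom(F, k) zero, so every cochain is a cocycle and the
only coboundary is 0. -/
lemma IsMinimalFreeResolution.extLinearMap_bijective {M : ModuleCat.{u} A}
    {F : ProjectiveResolution M} (hF : IsMinimalFreeResolution F) (n : ℕ) :
    Function.Bijective (hF.extLinearMap (n + 1)) := by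
  refine ⟨(injective_iff_map_eq_zero _).2 fun f hf => ?_, fun x => ?_⟩
  · obtain ⟨g, rfl⟩ := (F.extMk_eq_zero_iff f _ rfl (hF.d_comp _ f) n rfl).1 hf
    exact hF.d_comp n g
  · obtain ⟨f, hf, rfl⟩ := F.extMk_surjective x (n + 2) rfl
    exact ⟨f, rfl⟩

lemma length_hom_residueModule (F : ModuleCat.{u} A) [Module.Finite A F] [Module.Free A F] :
    Module.length A (F ⟶ residueModule A) = Module.finrank A F := by
  let b := Module.finBasis A F
  have : IsSimpleModule A (IsLocalRing.ResidueField A) :=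
    isSimpleModule_iff_quot_maximal.2 ⟨IsLocalRing.maximalIdeal A, inferInstance,
      ⟨LinearEquiv.refl A _⟩⟩
  rw [((ModuleCat.homLinearEquiv (S := A)).trans (b.constr A).symm).length_eq, Module.length_pi]
  change _ * Module.length A (IsLocalRing.ResidueField A) = _
  rw [Module.length_eq_one]
  simp

/-- The length of `Ext^n(M, k)`, which is the `n`th Betti number if `n > 0`. -/
def extLength (M : ModuleCat.{u} A) (n : ℕ) : ℕ∞ :=
  Module.length A (Ext M (residueModule A) n)

lemma IsMinimalFreeResolution.finrank_eq {M : ModuleCat.{u} A} {F : ProjectiveResolution M}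
    (hF : IsMinimalFreeResolution F) (n : ℕ) :
    (Module.finrank A (F.complex.X (n + 1)) : ℕ∞) = extLength M (n + 1) := by
  have := (hF.1 (n + 1)).1
  have := (hF.1 (n + 1)).2
  rw [← length_hom_residueModule]
  exact (LinearEquiv.ofBijective _ (hF.extLinearMap_bijective n)).length_eq

/-- A minimal resolution exists, so the infimum is attained; comparing ranks with Ext makes the
choice of resolution irrelevant. -/
lemma bettiNumber_eq_extLength [IsNoetherianRing A] (M : ModuleCat.{u} A) [hM : Module.Finite A M]
    (n : ℕ) : (bettiNumber M (n + 1) : ℕ∞) = extLength M (n + 1) := by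
  have hF := isMinimalFreeResolution_minimalResolution ⟨M, hM⟩
  obtain ⟨F', hF', h⟩ := Nat.sInf_mem (s := {b : ℕ | ∃ F : ProjectiveResolution M,
    IsMinimalFreeResolution F ∧ b = Module.finrank A (F.complex.X (n + 1))}) ⟨_, _, hF, rfl⟩
  rw [bettiNumber, h, hF'.finrank_eq]

variable {S : ShortComplex (ModuleCat.{u} A)}

lemma extLength_X₂_le (hS : S.ShortExact) (n : ℕ) :
    extLength S.X₂ n ≤ extLength S.X₃ n + extLength S.X₁ n :=
  Module.length_le_add_of_ker_le_range ((Ext.mk₀ S.g).precompOfLinear A (residueModule A) (zero_add n))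
    ((Ext.mk₀ S.f).precompOfLinear A (residueModule A) (zero_add n)) fun x hx =>
    Ext.contravariant_sequence_exact₂ hS _ x hx

lemma extLength_X₁_le (hS : S.ShortExact) (n : ℕ) :
    extLength S.X₁ n ≤ extLength S.X₂ n + extLength S.X₃ (1 + n) :=
  Module.length_le_add_of_ker_le_range ((Ext.mk₀ S.f).precompOfLinear A (residueModule A) (zero_add n))
    (hS.extClass.precompOfLinear A (residueModule A) rfl) fun x hx =>
    Ext.contravariant_sequence_exact₁ hS _ x rfl hx

lemma extLength_le_of_retract {M N : ModuleCat.{u} A} (i : N ⟶ M) (r : M ⟶ N)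
    (h : i ≫ r = 𝟙 N) (n : ℕ) : extLength N n ≤ extLength M n := by
  refine Module.length_le_of_injective
    ((Ext.mk₀ r).precompOfLinear A (residueModule A) (zero_add n)) ?_
  refine Function.LeftInverse.injective
    (g := (Ext.mk₀ i).precompOfLinear A (residueModule A) (zero_add n)) fun x => ?_
  change (Ext.mk₀ i).comp ((Ext.mk₀ r).comp x (zero_add n)) (zero_add n) = x
  rw [Ext.mk₀_comp_mk₀_assoc, h, Ext.mk₀_id_comp]

lemma extLength_eq_zero_of_projective (M : ModuleCat.{u} A) [Projective M] (n : ℕ) :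
    extLength M (n + 1) = 0 :=
  have := Ext.subsingleton_of_projective M (residueModule A) n
  Module.length_eq_zero

end BettiExt

/-! ### Finite complexity -/

section FiniteComplexity

variable {A : Type u} [CommRing A] [IsLocalRing A]

lemma complexity_lt_top_iff (M : ModuleCat.{u} A) :
    complexity M < ⊤ ↔ ∃ C d : ℕ, ∀ᶠ n : ℕ in atTop, bettiNumber M n ≤ C * n ^ d := by
  simp only [complexity, iInf_lt_iff]
  constructor
  · rintro ⟨c, ⟨α, hα⟩, -⟩
    obtain ⟨C, hC⟩ := exists_nat_ge α
    refine ⟨C, c, ?_⟩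
    filter_upwards [hα, eventually_ge_atTop 1] with n hn h1
    have hn1 : (1 : ℝ) ≤ n := by exact_mod_cast h1
    -- For c = 0 the exponent is -1; replacing c - 1 by c keeps it natural and is harmless for n ≥
    -- 1.
    have : (n : ℝ) ^ ((c : ℤ) - 1) ≤ (n : ℝ) ^ c := by
      rw [← zpow_natCast]
      exact zpow_le_zpow_right₀ hn1 (by lia)
    have hpos : (0 : ℝ) ≤ (n : ℝ) ^ ((c : ℤ) - 1) := by positivity
    have : (bettiNumber M n : ℝ) ≤ C * (n : ℝ) ^ c :=
      hn.trans ((mul_le_mul_of_nonneg_right hC hpos).trans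
        (mul_le_mul_of_nonneg_left this (Nat.cast_nonneg C)))
    exact_mod_cast this
  · rintro ⟨C, d, h⟩
    refine ⟨d + 1, ⟨C, ?_⟩, ENat.natCast_lt_top _⟩
    filter_upwards [h] with n hn
    have e : ((d + 1 : ℕ) : ℤ) - 1 = (d : ℕ) := by push_cast; ring
    rw [e, zpow_natCast]
    exact_mod_cast hn

variable [IsNoetherianRing A]

/-- A finite module has finite complexity if and only if its `Ext` modules into the residue field
have polynomially bounded length. -/
lemma complexity_lt_top_iff_extLength (M : ModuleCat.{u} A) [Module.Finite A M] :
    complexity M < ⊤ ↔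
      ∃ C d : ℕ, ∀ᶠ n : ℕ in atTop, extLength M n ≤ ((C * n ^ d : ℕ) : ℕ∞) := by
  rw [complexity_lt_top_iff]
  refine exists_congr fun C => exists_congr fun d => eventually_congr ?_
  filter_upwards [eventually_ge_atTop 1] with n hn
  obtain ⟨n, rfl⟩ := Nat.exists_eq_add_of_le' hn
  rw [← bettiNumber_eq_extLength, Nat.cast_le]

lemma extLength_bound_add {a b : ℕ → ℕ∞}
    (ha : ∃ C d : ℕ, ∀ᶠ n : ℕ in atTop, a n ≤ ((C * n ^ d : ℕ) : ℕ∞))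
    (hb : ∃ C d : ℕ, ∀ᶠ n : ℕ in atTop, b n ≤ ((C * n ^ d : ℕ) : ℕ∞)) :
    ∃ C d : ℕ, ∀ᶠ n : ℕ in atTop, a n + b n ≤ ((C * n ^ d : ℕ) : ℕ∞) := by
  obtain ⟨C, d, ha⟩ := ha
  obtain ⟨C', d', hb⟩ := hb
  refine ⟨C + C', d + d', ?_⟩
  filter_upwards [ha, hb, eventually_ge_atTop 1] with n ha hb hn
  refine (add_le_add ha hb).trans ?_
  rw [← Nat.cast_add, Nat.cast_le, add_mul]
  gcongr <;> lia

lemma extLength_bound_shift {a : ℕ → ℕ∞}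
    (ha : ∃ C d : ℕ, ∀ᶠ n : ℕ in atTop, a n ≤ ((C * n ^ d : ℕ) : ℕ∞)) :
    ∃ C d : ℕ, ∀ᶠ n : ℕ in atTop, a (1 + n) ≤ ((C * n ^ d : ℕ) : ℕ∞) := by
  obtain ⟨C, d, ha⟩ := ha
  -- The factor 2 ^ d comes from 1 + n ≤ 2n for n ≥ 1.
  refine ⟨C * 2 ^ d, d, ?_⟩
  have ht : Tendsto (fun n : ℕ => 1 + n) atTop atTop := 
    tendsto_atTop_mono (fun n => Nat.le_add_left n 1) tendsto_id
  filter_upwards [ht.eventually ha, eventually_ge_atTop 1] with n ha hn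
  refine ha.trans ?_
  rw [Nat.cast_le, mul_assoc, ← mul_pow]
  gcongr
  lia

variable {S : ShortComplex (ModuleCat.{u} A)}

lemma complexity_X₂_lt_top (hS : S.ShortExact) (f₁ : Module.Finite A S.X₁)
    (f₂ : Module.Finite A S.X₂) (f₃ : Module.Finite A S.X₃) (h₁ : complexity S.X₁ < ⊤)
    (h₃ : complexity S.X₃ < ⊤) : complexity S.X₂ < ⊤ := by
  rw [complexity_lt_top_iff_extLength] at h₁ h₃ ⊢
  obtain ⟨C, d, h⟩ := extLength_bound_add h₃ h₁
  exact ⟨C, d, h.mono fun n hn => (extLength_X₂_le hS n).trans hn⟩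

lemma complexity_X₁_lt_top (hS : S.ShortExact) (f₁ : Module.Finite A S.X₁)
    (f₂ : Module.Finite A S.X₂) (f₃ : Module.Finite A S.X₃) (h₂ : complexity S.X₂ < ⊤)
    (h₃ : complexity S.X₃ < ⊤) : complexity S.X₁ < ⊤ := by
  rw [complexity_lt_top_iff_extLength] at h₂ h₃ ⊢
  obtain ⟨C, d, h⟩ := extLength_bound_add h₂ (extLength_bound_shift h₃)
  exact ⟨C, d, h.mono fun n hn => (extLength_X₁_le hS n).trans hn⟩

lemma complexity_lt_top_of_retract {M N : ModuleCat.{u} A} [Module.Finite A M] [Module.Finite A N]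
    (i : N ⟶ M) (r : M ⟶ N) (h : i ≫ r = 𝟙 N) (hM : complexity M < ⊤) : complexity N < ⊤ := by
  rw [complexity_lt_top_iff_extLength] at hM ⊢
  obtain ⟨C, d, hM⟩ := hM
  exact ⟨C, d, hM.mono fun n hn => (extLength_le_of_retract i r h n).trans hn⟩

lemma complexity_lt_top_of_projective (M : ModuleCat.{u} A) [Module.Finite A M]
    [Module.Projective A M] : complexity M < ⊤ := by
  rw [complexity_lt_top_iff_extLength]
  have : Projective M := (IsProjective.iff_projective (R := A) M).1 inferInstance
  refine ⟨0, 0, (eventually_ge_atTop 1).mono fun n hn => ?_⟩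
  obtain ⟨n, rfl⟩ := Nat.exists_eq_add_of_le' hn
  simp [extLength_eq_zero_of_projective]

end FiniteComplexity

/-! ### The class `CI_*` is resolving -/

section LowerCIResolving

variable {R : Type u} [CommRing R]

/-- The localization of a module at a prime ideal, as an object of the category of modules. -/
abbrev localizedAt (m : Ideal R) [m.IsPrime] (M : ModuleCat.{u} R) :
    ModuleCat.{u} (Localization.AtPrime m) :=
  ModuleCat.of (Localization.AtPrime m) (LocalizedModule m.primeCompl M)

/-- The localization of a morphism at a prime ideal. -/
def localizedAtMap (m : Ideal R) [m.IsPrime] {M N : ModuleCat.{u} R} (f : M ⟶ N) :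
    localizedAt m M ⟶ localizedAt m N :=
  ModuleCat.ofHom (IsLocalizedModule.mapExtendScalars m.primeCompl
    (LocalizedModule.mkLinearMap m.primeCompl M) (LocalizedModule.mkLinearMap m.primeCompl N)
    (Localization.AtPrime m) f.hom)

lemma localizedAtMap_comp (m : Ideal R) [m.IsPrime] {M N P : ModuleCat.{u} R} (f : M ⟶ N)
    (g : N ⟶ P) : localizedAtMap m f ≫ localizedAtMap m g = localizedAtMap m (f ≫ g) := by
  refine ModuleCat.hom_ext (LinearMap.ext fun x => ?_)
  exact (LinearMap.congr_fun (IsLocalizedModule.map_comp' m.primeCompl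
    (LocalizedModule.mkLinearMap m.primeCompl M) (LocalizedModule.mkLinearMap m.primeCompl N)
    (LocalizedModule.mkLinearMap m.primeCompl P) f.hom g.hom) x).symm

lemma localizedAtMap_id (m : Ideal R) [m.IsPrime] (M : ModuleCat.{u} R) :
    localizedAtMap m (𝟙 M) = 𝟙 (localizedAt m M) := by
  refine ModuleCat.hom_ext (LinearMap.ext fun x => ?_)
  exact LinearMap.congr_fun (IsLocalizedModule.map_id m.primeCompl
    (LocalizedModule.mkLinearMap m.primeCompl M)) x

lemma localizedAtMap_zero (m : Ideal R) [m.IsPrime] (M N : ModuleCat.{u} R) :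
    localizedAtMap m (0 : M ⟶ N) = 0 := by
  refine ModuleCat.hom_ext (LinearMap.ext fun x => ?_)
  exact LinearMap.congr_fun (map_zero (IsLocalizedModule.map m.primeCompl
    (LocalizedModule.mkLinearMap m.primeCompl M) (LocalizedModule.mkLinearMap m.primeCompl N))) x

/-- The localization of a short complex of modules at a prime ideal. -/
def localizedAtShortComplex (m : Ideal R) [m.IsPrime] (S : ShortComplex (ModuleCat.{u} R)) :
    ShortComplex (ModuleCat.{u} (Localization.AtPrime m)) :=
  ShortComplex.mk (localizedAtMap m S.f) (localizedAtMap m S.g) (by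
    rw [localizedAtMap_comp, S.zero, localizedAtMap_zero])

lemma shortExact_localizedAtShortComplex (m : Ideal R) [m.IsPrime]
    {S : ShortComplex (ModuleCat.{u} R)} (hS : S.ShortExact) :
    (localizedAtShortComplex m S).ShortExact :=
  ModuleCat.shortComplex_shortExact _
    (IsLocalizedModule.map_exact m.primeCompl (LocalizedModule.mkLinearMap m.primeCompl S.X₁)
      (LocalizedModule.mkLinearMap m.primeCompl S.X₂)
      (LocalizedModule.mkLinearMap m.primeCompl S.X₃) S.f.hom S.g.hom
      ((ShortComplex.ShortExact.moduleCat_exact_iff_function_exact _).1 hS.exact))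
    (IsLocalizedModule.map_injective m.primeCompl (LocalizedModule.mkLinearMap m.primeCompl S.X₁)
      (LocalizedModule.mkLinearMap m.primeCompl S.X₂) S.f.hom hS.moduleCat_injective_f)
    (IsLocalizedModule.map_surjective m.primeCompl (LocalizedModule.mkLinearMap m.primeCompl S.X₂)
      (LocalizedModule.mkLinearMap m.primeCompl S.X₃) S.g.hom hS.moduleCat_surjective_g)

lemma lowerCIClass_of_retract [IsNoetherianRing R] {M N : ModuleCat.{u} R} (i : N ⟶ M) (r : M ⟶ N)
    (h : i ≫ r = 𝟙 N) (hM : lowerCIClass R M) : lowerCIClass R N := by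
  have hN := hM.1.of_retract i r h
  refine ⟨hN, fun m _ => ?_⟩
  have := hN.finite
  have := hM.1.finite
  exact complexity_lt_top_of_retract (localizedAtMap m i) (localizedAtMap m r)
    (by rw [localizedAtMap_comp, h, localizedAtMap_id]) (hM.2 m)

theorem isResolvingSubclass_lowerCIClass (R : Type u) [CommRing R] [IsNoetherianRing R] :
    IsResolvingSubclass (lowerCIClass R) where
  finite M hM := hM.1.finite
  projective P _ _ := ⟨.of_projective P, fun m _ =>
    complexity_lt_top_of_projective (localizedAt m P)⟩
  exact S hS f₁ f₂ f₃ h₃ := by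
    have hfin (m : Ideal R) [m.IsMaximal] (M : ModuleCat.{u} R) (h : Module.Finite R M) :
        Module.Finite (Localization.AtPrime m) (localizedAt m M) := inferInstance
    constructor <;> intro h
    · refine ⟨.X₂_of_shortExact hS f₂ h.1 h₃.1, fun m hm => ?_⟩
      exact complexity_X₂_lt_top (S := localizedAtShortComplex m S)
        (shortExact_localizedAtShortComplex m hS) (hfin m S.X₁ f₁) (hfin m S.X₂ f₂)
        (hfin m S.X₃ f₃) (h.2 m) (h₃.2 m)
    · refine ⟨.X₁_of_shortExact hS f₁ h.1 h₃.1, fun m hm => ?_⟩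
      exact complexity_X₁_lt_top (S := localizedAtShortComplex m S)
        (shortExact_localizedAtShortComplex m hS) (hfin m S.X₁ f₁) (hfin m S.X₂ f₂)
        (hfin m S.X₃ f₃) (h.2 m) (h₃.2 m)
  summand L N _ _ h :=
    ⟨lowerCIClass_of_retract (ModuleCat.ofHom (LinearMap.inl R L N))
      (ModuleCat.ofHom (LinearMap.fst R L N)) (by ext; rfl) h,
    lowerCIClass_of_retract (ModuleCat.ofHom (LinearMap.inr R L N))
      (ModuleCat.ofHom (LinearMap.snd R L N)) (by ext; rfl) h⟩

end LowerCIResolving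

end

theorem mainTheorem12 {R : Type u} [CommRing R] [IsNoetherianRing R]
    (X : Fin 3 → ChainComplex (ModuleCat.{u} R) ℤ)
    (f : X 0 ⟶ X 1) (g : X 1 ⟶ X 2) (w : f ≫ g = 0)
    (hX : (ShortComplex.mk f g w).ShortExact)
    (hfin : ∀ t : Fin 3, IsHomologicallyFinite (X t))
    (i j k : Fin 3) (hijk : ({i, j, k} : Set (Fin 3)) = Set.univ) :
    (∀ B : ObjectProperty (ModuleCat.{u} R), IsResolvingSubclass B →
      classDim B (X k) ≤ max (classDim B (X i)) (classDim B (X j)) + 1 ∧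
      (classDim B (X i) < ⊤ → classDim B (X j) < ⊤ → classDim B (X k) < ⊤)) ∧
    IsResolvingSubclass (lowerCIClass R) ∧
    lowerCIDim (X k) ≤ max (lowerCIDim (X i)) (lowerCIDim (X j)) + 1 ∧
    (lowerCIDim (X i) < ⊤ → lowerCIDim (X j) < ⊤ → lowerCIDim (X k) < ⊤) := by
  have key : ∀ B : ObjectProperty (ModuleCat.{u} R), IsResolvingSubclass B →
      classDim B (X k) ≤ max (classDim B (X i)) (classDim B (X j)) + 1 ∧
      (classDim B (X i) < ⊤ → classDim B (X j) < ⊤ → classDim B (X k) < ⊤) := fun B hB =>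
    ⟨classDim_le_of_shortExact hB X f g w hX i j k hijk,
      classDim_lt_top_of_shortExact hB X f g w hX i j k hijk⟩
  exact ⟨key, isResolvingSubclass_lowerCIClass R, key _ (isResolvingSubclass_lowerCIClass R)⟩
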